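/- All graphs are finite, simple and undirected. A vertex of a tree is internal if its degree is at least $2$; a maximum internal spanning tree (MIST) of a connected graph $G$ is a spanning tree of $G$ with the largest number of internal vertices among all spanning trees of $G$. A bipartite permutation graph is a bipartite graph whose vertices can be numbered $v_1,\dots,v_n$ so that for some permutation $\sigma$ of $\{1,\dots,n\}$: $v_iv_j\in E(G)$ if and only if $(i-j)(\sigma(i)-\sigma(j))<0$. A strong ordering of a bipartite graph $G=(X,Y,E)$ consists of orderings $X=(x_1,\dots,x_{n_1})$ and $Y=(y_1,\dots,y_{n_2})$ such that, whenever $x_iy_j$ and $x_{i'}y_{j'}$ are edges with $i<i'$ and $j'<j$, also $x_iy_{j'}$ and $x_{i'}y_j$ are edges. Given such an ordering, the last neighbour $l(v)$ of a vertex $v$ is its neighbour of largest index. A vertex $x_i$ with $l(x_i)=y_j$ is of type 1 if $j\ge i$ and of type 2 if $j\ge i+1$; a vertex $y_i$ with $l(y_i)=x_j$ is of type 1 if $j\ge i+1$ and of type 2 if $j\ge i$ (a vertex without neighbours is of neither type). Let $\alpha=(x_1,y_1,x_2,y_2,\dots)$ and $\beta=(y_1,x_1,y_2,x_2,\dots)$,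 where indices that do not occur are skipped. **Algorithm.** Input: a connected bipartite permutation graph $G$ with a strong ordering $(x_1,\dots,x_{n_1},y_1,\dots,y_{n_2})$. Start with $E(T)=\emptyset$ and $flag=1$. "Removing" a vertex $x_k$ (or $y_k$) means: delete it from the remaining graph, rename $x_i$ as $x_{i-1}$ (or $y_i$ as $y_{i-1}$) for all $i>k$, and decrease $n_1$ (or $n_2$) by $1$; types, orders and indices always refer to the remaining graph and the current names. * While $flag=1$: going on in the order $\alpha$ from the current position (at first from $x_1$; after a removal, from the place of the removed vertex), find the next vertex $u$ that is not of type 1. - If $u=x_{k+1}$ and $k+1\ne n_1$: add the edge $y_ku$ to $E(T)$ and remove $u$. If $u=x_{k+1}$ and $k+1=n_1$: add the edges of the path $x_1y_1x_2y_2\cdots x_ky_kx_{k+1}$ to $E(T)$ and return $T$. - If $u=y_k$ and $x_iy_{i+1}\in E(G)$ for all $1\le i\le k-1$: put $flag=2$ and start visiting in the order $\beta$ from $y_1$. - If $u=y_k$ and this condition fails: if $k\ne n_2$, add the edge $x_ku$ to $E(T)$ and remove $u$; if $k=n_2$, add the edges of the path $x_1y_1x_2y_2\cdots x_ky_k$ to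 $E(T)$ and return $T$. * While $flag=2$: going on in the order $\beta$ from the current position, find the next vertex $u$ that is not of type 2. - If $u=y_{k+1}$ and $k+1\ne n_2$: add the edge $x_ku$ to $E(T)$ and remove $u$. If $u=y_{k+1}$ and $k+1=n_2$: add the edges of the path $y_1x_1y_2x_2\cdots y_kx_ky_{k+1}$ to $E(T)$ and return $T$. - If $u=x_k$ and $k\ne n_1$: add the edge $y_ku$ to $E(T)$ and remove $u$. If $u=x_k$ and $k=n_1$: add the edges of the path $y_1x_1y_2x_2\cdots y_kx_k$ to $E(T)$ and return $T$. **Theorem.** For every connected bipartite permutation graph $G$ with bipartition $(X,Y)$ and every strong ordering of $G$, the algorithm halts and returns (the edge set of) a spanning tree $T$ of $G$ that is a maximum internal spanning tree of $G$. -/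

import Mathlib

namespace BipPermMIST

/-! ### Graph-theoretic notions -/

/-- `G` is a permutation graph: for some numbering of the vertices and some permutation `σ`,
two vertices are adjacent iff `σ` reverses their order. -/
def IsPermutationGraph {V : Type*} (G : SimpleGraph V) : Prop :=
  ∃ (n : ℕ) (e : V ≃ Fin n) (σ : Equiv.Perm (Fin n)), ∀ u v : V,
    G.Adj u v ↔
      (((e u : ℕ) : ℤ) - ((e v : ℕ) : ℤ)) * (((σ (e u) : ℕ) : ℤ) - ((σ (e v) : ℕ) : ℤ)) < 0

/-- A bipartite graph that is also a permutation graph. -/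
def IsBipartitePermutationGraph {V : Type*} (G : SimpleGraph V) : Prop :=
  G.IsBipartite ∧ IsPermutationGraph G

/-- `x 1, …, x n₁` and `y 1, …, y n₂` enumerate, without repetition, the two sides `X` and `Y` of
a bipartition of the vertex set such that every edge joins `X` to `Y`. Values of `x` and `y` at
other indices play no role. -/
structure IsBipartitionEnumeration {V : Type*} (G : SimpleGraph V) (n₁ n₂ : ℕ)
    (x y : ℕ → V) : Prop where
  injOn_x : Set.InjOn x (Set.Icc 1 n₁)
  injOn_y : Set.InjOn y (Set.Icc 1 n₂)
  cover : x '' Set.Icc 1 n₁ ∪ y '' Set.Icc 1 n₂ = Set.univ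
  bipartite : G.IsBipartiteWith (x '' Set.Icc 1 n₁) (y '' Set.Icc 1 n₂)

/-- The orderings `(x 1, …, x n₁)` and `(y 1, …, y n₂)` of the two sides form a strong ordering:
if `ab` and `a'b'` are edges with `a <_X a'` and `b' <_Y b`, then `ab'` and `a'b` are edges. -/
def IsStrongOrdering {V : Type*} (G : SimpleGraph V) (n₁ n₂ : ℕ) (x y : ℕ → V) : Prop :=
  ∀ i ∈ Set.Icc 1 n₁, ∀ i' ∈ Set.Icc 1 n₁, ∀ j ∈ Set.Icc 1 n₂, ∀ j' ∈ Set.Icc 1 n₂,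
    G.Adj (x i) (y j) → G.Adj (x i') (y j') → i < i' → j' < j →
      G.Adj (x i) (y j') ∧ G.Adj (x i') (y j)

/-- The number of internal vertices of `T`, that is, of vertices of degree at least `2`. -/
noncomputable def internalCount {V : Type*} (T : SimpleGraph V) : ℕ :=
  {v : V | 2 ≤ (T.neighborSet v).ncard}.ncard

/-- `T` (a graph on the whole vertex set of `G`) is a spanning tree of `G`. -/
def IsSpanningTree {V : Type*} (G T : SimpleGraph V) : Prop :=
  T ≤ G ∧ T.IsTree

/-- `T` is a maximum internal spanning tree of `G`. -/
def IsMIST {V : Type*} (G T : SimpleGraph V) : Prop :=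
  IsSpanningTree G T ∧
    ∀ T' : SimpleGraph V, IsSpanningTree G T' → internalCount T' ≤ internalCount T

/-! ### The algorithm -/

/-- The place of a vertex in the current naming: `X i` stands for `x_i`, `Y i` for `y_i`
(indices start at `1`). -/
inductive Slot where
  | X (i : ℕ)
  | Y (i : ℕ)

/-- The visiting order `α = (x_1, y_1, x_2, y_2, …)`, with positions counted from `0`. -/
def alpha (p : ℕ) : Slot :=
  if p % 2 = 0 then Slot.X (p / 2 + 1) else Slot.Y (p / 2 + 1)

/-- The visiting order `β = (y_1, x_1, y_2, x_2, …)`, with positions counted from `0`. -/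
def beta (p : ℕ) : Slot :=
  if p % 2 = 0 then Slot.Y (p / 2 + 1) else Slot.X (p / 2 + 1)

/-- The variables of the algorithm: the current numbers `n₁`, `n₂` of remaining vertices of the
two sides, their current names `x 1, …, x n₁` and `y 1, …, y n₂`, the flag (`flag2 = false` is
`flag = 1`, `flag2 = true` is `flag = 2`), the position `pos` in the current visiting order at
which the search goes on, and the set `E` of tree edges collected so far. -/
structure State (V : Type*) where
  n₁ : ℕ
  n₂ : ℕ
  x : ℕ → V
  y : ℕ → V
  flag2 : Bool
  pos : ℕ
  E : Finset (Sym2 V)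

/-- The largest index `j ∈ {1, …, n}` such that `L j` is a neighbour of `v` (the index of the last
neighbour `l(v)`), and `0` if there is none. -/
def lastNbr {V : Type*} (G : SimpleGraph V) [DecidableRel G.Adj] (L : ℕ → V) (n : ℕ) (v : V) : ℕ :=
  ((Finset.Icc 1 n).filter fun j => G.Adj v (L j)).sup id

section Algorithm

variable {V : Type*} [DecidableEq V] (G : SimpleGraph V) [DecidableRel G.Adj]

/-- The slot is occupied by a remaining vertex. -/
def State.present (s : State V) : Slot → Bool
  | Slot.X i => decide (1 ≤ i ∧ i ≤ s.n₁)
  | Slot.Y i => decide (1 ≤ i ∧ i ≤ s.n₂)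

/-- Type 1 (in the remaining graph): `x_i` with `l(x_i) = y_j`, `j ≥ i`;
`y_i` with `l(y_i) = x_j`, `j ≥ i + 1`. -/
def State.isType1 (s : State V) : Slot → Bool
  | Slot.X i => decide (i ≤ lastNbr G s.y s.n₂ (s.x i))
  | Slot.Y i => decide (i + 1 ≤ lastNbr G s.x s.n₁ (s.y i))

/-- Type 2 (in the remaining graph): `x_i` with `l(x_i) = y_j`, `j ≥ i + 1`;
`y_i` with `l(y_i) = x_j`, `j ≥ i`. -/
def State.isType2 (s : State V) : Slot → Bool
  | Slot.X i => decide (i + 1 ≤ lastNbr G s.y s.n₂ (s.x i))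
  | Slot.Y i => decide (i ≤ lastNbr G s.x s.n₁ (s.y i))

/-- Search from position `pos` on for the next remaining vertex that is not of type 1 in the order
`α` (if `flag = 1`) or not of type 2 in the order `β` (if `flag = 2`); returns its position.
All remaining vertices have positions below `2 * (n₁ + n₂)`. -/
def State.nextEncountered (s : State V) : Option ℕ :=
  (List.range (2 * (s.n₁ + s.n₂))).find? fun p =>
    decide (s.pos ≤ p) &&
      if s.flag2 then s.present (beta p) && !s.isType2 G (beta p)
      else s.present (alpha p) && !s.isType1 G (alpha p)

/-- Drop the `k`-th entry and rename the later ones: entry `i` becomes entry `i - 1`, `i > k`. -/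
def dropAt {V : Type*} (L : ℕ → V) (k : ℕ) : ℕ → V :=
  fun i => if i < k then L i else L (i + 1)

/-- Make `x_i` a pendant vertex hanging on `y_j`, and remove it; the search goes on at `p`. -/
def State.peelX (s : State V) (i j p : ℕ) : State V :=
  { s with
    E := insert s(s.y j, s.x i) s.E
    x := dropAt s.x i
    n₁ := s.n₁ - 1
    pos := p }

/-- Make `y_i` a pendant vertex hanging on `x_j`, and remove it; the search goes on at `p`. -/
def State.peelY (s : State V) (i j p : ℕ) : State V :=
  { s with
    E := insert s(s.x j, s.y i) s.E
    y := dropAt s.y i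
    n₂ := s.n₂ - 1
    pos := p }

/-- The edges of the path `a_1 b_1 a_2 b_2 … a_k b_k`. -/
def evenPath (a b : ℕ → V) (k : ℕ) : Finset (Sym2 V) :=
  (Finset.Icc 1 k).image (fun i => s(a i, b i)) ∪
    (Finset.Icc 1 (k - 1)).image (fun i => s(b i, a (i + 1)))

/-- The edges of the path `a_1 b_1 a_2 b_2 … a_k b_k a_{k+1}`. -/
def oddPath (a b : ℕ → V) (k : ℕ) : Finset (Sym2 V) :=
  (Finset.Icc 1 k).image (fun i => s(a i, b i)) ∪
    (Finset.Icc 1 k).image (fun i => s(b i, a (i + 1)))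

/-- The outcome of one round of a while loop. -/
inductive Outcome (V : Type*) where
  | next (s : State V)
  | ret (E : Finset (Sym2 V))
  | stuck

/-- One round of the while loop for `flag = 1` or `flag = 2`, preceded by the search for the
encountered vertex `u`; `stuck` if the search finds no vertex. -/
def step (s : State V) : Outcome V :=
  match s.nextEncountered G with
  | none => Outcome.stuck
  | some p =>
    if s.flag2 = false then
      match alpha p with
      | Slot.X i =>
        -- here `u = x_{k+1}` with `k + 1 = i`
        if i ≠ s.n₁ then Outcome.next (s.peelX i (i - 1) p)
        else Outcome.ret (s.E ∪ oddPath s.x s.y (i - 1))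
      | Slot.Y k =>
        if ∀ i ∈ Finset.Icc 1 (k - 1), G.Adj (s.x i) (s.y (i + 1)) then
          -- search again from `y_1` on, in the order `β`
          Outcome.next { s with flag2 := true, pos := 0 }
        else if k ≠ s.n₂ then Outcome.next (s.peelY k k p)
        else Outcome.ret (s.E ∪ evenPath s.x s.y k)
    else
      match beta p with
      | Slot.Y i =>
        -- here `u = y_{k+1}` with `k + 1 = i`
        if i ≠ s.n₂ then Outcome.next (s.peelY i (i - 1) p)
        else Outcome.ret (s.E ∪ oddPath s.y s.x (i - 1))
      | Slot.X k =>
        if k ≠ s.n₁ then Outcome.next (s.peelX k k p)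
        else Outcome.ret (s.E ∪ evenPath s.y s.x k)

/-- Run at most `m` rounds; `some E` if the algorithm has returned `E` by then. -/
def run : ℕ → State V → Option (Finset (Sym2 V))
  | 0, _ => none
  | m + 1, s =>
    match step G s with
    | Outcome.next s' => run m s'
    | Outcome.ret E => some E
    | Outcome.stuck => none

/-- The initial state: all vertices remain, `flag = 1`, and no edge has been chosen. -/
def initialState (n₁ n₂ : ℕ) (x y : ℕ → V) : State V where
  n₁ := n₁
  n₂ := n₂
  x := x
  y := y
  flag2 := false
  pos := 0
  E := ∅

/-- On input `G` with the orderings `x 1, …, x n₁` and `y 1, …, y n₂`, the algorithm halts and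
returns the graph `T` on the vertex set of `G`, given by its edge set. -/
def AlgorithmReturns (n₁ n₂ : ℕ) (x y : ℕ → V) (T : SimpleGraph V) : Prop :=
  ∃ (m : ℕ) (E : Finset (Sym2 V)),
    run G m (initialState n₁ n₂ x y) = some E ∧ (E : Set (Sym2 V)) = T.edgeSet

end Algorithm

end BipPermMIST

/-! Interleave the two sides in the visiting order and count positions from 0. In both orders the
type condition says that a vertex has a neighbour at a later position (`Good`), so one argument
about positions serves both flags. If `p` is the first position that is not good, the strong
ordering forces consecutive positions up to `p` to be adjacent (`Staircase.adj_succ_of_lt`). If the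
side of `p` continues after it, `p` is hung on `p - 1`, and the rest is again a staircase
(`Staircase.remove`). Otherwise nothing lies beyond `p` (`Staircase.le_of_last`), and the path `0,
…, p` with the pendant vertices is a spanning tree. Its leaves are among the `d` removed vertices
and the two ends of the path, so it suffices that every spanning tree has at least `d + 2` leaves.

That bound comes from counting edges of forests: if an independent set `A` has all its neighbours in
`B`, every spanning tree has at least `|A| + 1 - |B|` leaves in `A` (`leafBound_of_neighbors`), and
such bounds add over disjoint sets. A `Cert` keeps a settled bound on `S` and one open pair `(A,
B)`. If the next event is on the same side as `A`, the pair absorbs the alternating stretch of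
positions up to `p`, which has one more vertex on the side of `A` (`Cert.extend_same`). If it is on
the other side, the open pair is settled, its `+ 1` pays for the event, and the stretch, balanced
this time, becomes the new pair (`Cert.extend_opp`). So each event gains one, the final one
included, and the last open pair gives one more: `d + 2`.

To start, one needs a first event at an even position or a nonempty balanced pair. The latter exists
if some even position has no neighbour more than one place later: the even positions up to it have
no more neighbours than members (`Cert.of_wall`). The test before the switch of flags looks for such
a wall. If there is none, the order `β` begins with an even event, or has a wall of its own, or
gives a Hamiltonian path, where the two leaves of any tree suffice. -/

namespace BipPermMIST

/-! ### Lower bounds on the number of leaves -/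

/-- Every spanning tree of `G` has at least `k` vertices of degree less than `2` in `S`. -/
def LeafBound {V : Type*} (G : SimpleGraph V) (S : Set V) (k : ℕ) : Prop :=
  ∀ T, IsSpanningTree G T → k ≤ {v ∈ S | ¬ 2 ≤ (T.neighborSet v).ncard}.ncard

section LeafBound

variable {V : Type*} [Fintype V] {G : SimpleGraph V}

theorem LeafBound.mono {S S' : Set V} {k k' : ℕ} (h : LeafBound G S k) (hS : S ⊆ S')
    (hk : k' ≤ k) : LeafBound G S' k' := fun T hT =>
  (hk.trans (h T hT)).trans (Set.ncard_le_ncard fun _ hv => ⟨hS hv.1, hv.2⟩)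

theorem LeafBound.union {S S' : Set V} {k k' : ℕ} (h : LeafBound G S k) (h' : LeafBound G S' k')
    (hd : Disjoint S S') : LeafBound G (S ∪ S') (k + k') := by
  intro T hT
  have := h T hT
  have := h' T hT
  have hu : {v ∈ S ∪ S' | ¬ 2 ≤ (T.neighborSet v).ncard} =
      {v ∈ S | ¬ 2 ≤ (T.neighborSet v).ncard} ∪ {v ∈ S' | ¬ 2 ≤ (T.neighborSet v).ncard} := by
    ext v
    simp only [Set.mem_union, Set.mem_ofPred_eq]
    tauto
  rw [hu, Set.ncard_union_eq]
  · omega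
  · exact hd.mono (fun _ hv => hv.1) (fun _ hv => hv.1)

/-- A forest has fewer edges than vertices, applied to the edges at an independent set `A`
whose neighbours lie in `B`. -/
theorem sum_ncard_neighborSet_lt {T : SimpleGraph V} (hT : T.IsAcyclic) {A B : Finset V}
    (hA : A.Nonempty) (hind : ∀ u ∈ A, ∀ v ∈ A, ¬ T.Adj u v)
    (hB : ∀ u ∈ A, ∀ v, T.Adj u v → v ∈ B) :
    ∑ a ∈ A, (T.neighborSet a).ncard + 1 ≤ A.card + B.card := by
  classical
  set S : Set V := ↑(A ∪ B) with hS
  obtain ⟨a₀, ha₀⟩ := hA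
  have : Nonempty S := ⟨⟨a₀, by simp [hS, ha₀]⟩⟩
  -- Completing the forest induced on `A ∪ B` to a tree makes the exact edge count available.
  obtain ⟨F, hF, -, hFT⟩ := (SimpleGraph.connected_top (V := S)).exists_isTree_le_of_le_of_isAcyclic
    (H := T.induce S) le_top (hT.induce S)
  have hcard := hFT.card_edgeFinset
  have hVS : Fintype.card S ≤ A.card + B.card := by
    have : Fintype.card S = (A ∪ B).card := by simp [hS]
    rw [this]
    exact Finset.card_union_le A B
  have hsum : ∑ a ∈ A, (T.neighborSet a).ncard = (A.sigma fun a => T.neighborFinset a).card := by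
    rw [Finset.card_sigma]
    refine Finset.sum_congr rfl fun a _ => ?_
    rw [Set.ncard_eq_toFinset_card', SimpleGraph.neighborFinset]
  have hle : (A.sigma fun a => T.neighborFinset a).card ≤ F.edgeFinset.card := by
    have hmem : ∀ p ∈ A.sigma fun a => T.neighborFinset a, ∃ h₁ : p.1 ∈ S, ∃ h₂ : p.2 ∈ S,
        F.Adj ⟨p.1, h₁⟩ ⟨p.2, h₂⟩ := by
      intro p hp
      simp only [Finset.mem_sigma, SimpleGraph.mem_neighborFinset] at hp
      refine ⟨by simp [hS, hp.1], by simp [hS, hB _ hp.1 _ hp.2], hF ?_⟩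
      simpa using hp.2
    -- The default pair is never taken. Injectivity rests on the independence of `A`: no edge of `T`
    -- is counted from both ends.
    refine Finset.card_le_card_of_injOn
      (fun p => if h : p.1 ∈ S ∧ p.2 ∈ S then s(⟨p.1, h.1⟩, ⟨p.2, h.2⟩) else
        s(Classical.arbitrary S, Classical.arbitrary S)) ?_ ?_
    · intro p hp
      obtain ⟨h₁, h₂, h⟩ := hmem p hp
      simp only [h₁, h₂, and_self, dite_true]
      simpa using h
    · intro p hp q hq hpq
      obtain ⟨h₁, h₂, -⟩ := hmem p hp
      obtain ⟨h₃, h₄, -⟩ := hmem q hq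
      obtain ⟨p₁, p₂⟩ := p
      obtain ⟨q₁, q₂⟩ := q
      simp only [Finset.coe_sigma, Set.mem_sigma_iff, Finset.mem_coe,
        SimpleGraph.mem_neighborFinset] at hp hq h₁ h₂ h₃ h₄
      simp only [h₁, h₂, h₃, h₄, and_self, dite_true, Sym2.eq_iff, Subtype.mk.injEq] at hpq
      rcases hpq with ⟨rfl, rfl⟩ | ⟨rfl, rfl⟩
      · rfl
      · exact (hind _ hp.1 _ hq.1 hp.2).elim
  omega

/-- In a spanning tree each vertex of `A` has degree at least 1, and at least 2 unless it is a leaf.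
So the degree sum over `A` is at least `2|A|` minus the number of leaves, while the forest bound
keeps it below `|A| + |B|`. -/
theorem leafBound_of_neighbors [Nontrivial V] {A B : Finset V} (hA : A.Nonempty)
    (hind : ∀ u ∈ A, ∀ v ∈ A, ¬ G.Adj u v) (hB : ∀ u ∈ A, ∀ v, G.Adj u v → v ∈ B) :
    LeafBound G A (A.card + 1 - B.card) := by
  classical
  intro T hT
  have h := sum_ncard_neighborSet_lt hT.2.isAcyclic hA
    (fun u hu v hv huv => hind u hu v hv (hT.1 huv)) (fun u hu v huv => hB u hu v (hT.1 huv))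
  have hpos : ∀ a ∈ A, 1 ≤ (T.neighborSet a).ncard := by
    intro a _
    obtain ⟨b, hb⟩ := hT.2.connected.preconnected.exists_adj_of_nontrivial a
    exact (Set.ncard_pos (Set.toFinite _)).2 ⟨b, hb⟩
  have hl : {v ∈ (A : Set V) | ¬ 2 ≤ (T.neighborSet v).ncard}.ncard =
      (A.filter fun v => ¬ 2 ≤ (T.neighborSet v).ncard).card := by
    rw [← Set.ncard_coe_finset]
    congr 1
    ext v
    simp
  have hsum : 2 * A.card ≤ ∑ a ∈ A, (T.neighborSet a).ncard +
      (A.filter fun v => ¬ 2 ≤ (T.neighborSet v).ncard).card := by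
    rw [Finset.card_filter, ← Finset.sum_add_distrib, mul_comm, ← smul_eq_mul, ← Finset.sum_const]
    refine Finset.sum_le_sum fun a ha => ?_
    have := hpos a ha
    split_ifs <;> omega
  rw [hl]
  omega

theorem isMIST_of_leafBound {T : SimpleGraph V} {k : ℕ} (hT : IsSpanningTree G T)
    (hk : LeafBound G Set.univ k) (hle : {v : V | ¬ 2 ≤ (T.neighborSet v).ncard}.ncard ≤ k) :
    IsMIST G T := by
  refine ⟨hT, fun T' hT' => ?_⟩
  have h' := hk T' hT'
  have e₁ := Set.ncard_add_ncard_compl {v : V | 2 ≤ (T.neighborSet v).ncard}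
  have e₂ := Set.ncard_add_ncard_compl {v : V | 2 ≤ (T'.neighborSet v).ncard}
  simp only [Set.compl_ofPred, Set.mem_univ, true_and] at e₁ e₂ h'
  unfold internalCount
  omega

end LeafBound

end BipPermMIST

namespace BipPermMIST

/-! ### Positions of the vertices of a strongly ordered connected bipartite graph -/

/-- The combinatorics of a strong ordering in terms of positions: the two sides occupy initial
segments (`P`) of the even and of the odd numbers, and `R` is the adjacency relation. -/
structure Staircase (P : ℕ → Prop) (R : ℕ → ℕ → Prop) : Prop where
  down : ∀ q, P (q + 2) → P q
  left : ∀ q r, R q r → P q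
  symm : ∀ q r, R q r → R r q
  parity : ∀ q r, R q r → (q + r) % 2 = 1
  cross : ∀ q r q' r', R q r → R q' r' → q < q' → r' < r → (q + q') % 2 = 0 → R q r' ∧ R q' r
  nbr : ∀ q, P q → ∃ r, R q r
  conn : ∀ q, P (q + 2) → ∃ r, R q r ∧ R (q + 2) r

/-- The position `q` has a neighbour at a later position. -/
def Good (R : ℕ → ℕ → Prop) (q : ℕ) : Prop := ∃ r, q < r ∧ R q r

/-- The old position of the entry at position `q` after the entry at `p` has been dropped. -/
def skip (p q : ℕ) : ℕ := if p ≤ q ∧ (p + q) % 2 = 0 then q + 2 else q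

theorem skip_parity (p q : ℕ) : skip p q % 2 = q % 2 := by
  unfold skip; split_ifs <;> omega

theorem skip_ne (p q : ℕ) : skip p q ≠ p := by
  unfold skip; split_ifs <;> omega

theorem skip_of_lt {p q : ℕ} (h : q < p) : skip p q = q := by
  unfold skip; split_ifs <;> omega

theorem skip_of_odd {p q : ℕ} (h : (p + q) % 2 = 1) : skip p q = q := by
  unfold skip; split_ifs <;> omega

theorem skip_of_even {p q : ℕ} (h : (p + q) % 2 = 0) (hq : p ≤ q) : skip p q = q + 2 := by
  unfold skip; split_ifs <;> omega

theorem le_skip (p q : ℕ) : q ≤ skip p q := by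
  unfold skip; split_ifs <;> omega

theorem lt_skip {p q : ℕ} (h : p ≤ q) : p < skip p q := by
  unfold skip; split_ifs <;> omega

theorem skip_lt_skip {p q r : ℕ} (h : q < r) (hp : (q + r) % 2 = 0) : skip p q < skip p r := by
  unfold skip; split_ifs <;> omega

theorem skip_injective (p : ℕ) : Function.Injective (skip p) := by
  intro q r h
  unfold skip at h
  split_ifs at h <;> omega

theorem exists_skip_eq {p s : ℕ} (h : s ≠ p) : ∃ r, skip p r = s := by
  by_cases hs : p < s ∧ (p + s) % 2 = 0
  · exact ⟨s - 2, by unfold skip; split_ifs <;> omega⟩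
  · exact ⟨s, by unfold skip; split_ifs <;> omega⟩

namespace Staircase

variable {P : ℕ → Prop} {R : ℕ → ℕ → Prop}

theorem right (h : Staircase P R) {q r : ℕ} (hqr : R q r) : P r := h.left _ _ (h.symm _ _ hqr)

theorem of_le (h : Staircase P R) {q r : ℕ} (hr : P r) (hqr : q ≤ r) (hp : (q + r) % 2 = 0) :
    P q := by
  obtain ⟨k, rfl⟩ : ∃ k, r = q + 2 * k := ⟨(r - q) / 2, by omega⟩
  clear hp hqr
  induction k with
  | zero => exact hr
  | succ k ih => exact ih (h.down _ hr)

/-- Last neighbours are monotone along a side: an edge from an earlier `r` past `L` would cross an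
edge at `e`, and crossing would give `e` a neighbour past `L`. -/
theorem nbr_le (h : Staircase P R) {e L r s : ℕ} (he : P e) (hL : ∀ s, R e s → s ≤ L)
    (hr : r ≤ e) (hp : (r + e) % 2 = 0) (hrs : R r s) : s ≤ L := by
  by_contra! hs
  rcases hr.eq_or_lt with rfl | hr
  · exact absurd (hL _ hrs) (by omega)
  · obtain ⟨s', hs'⟩ := h.nbr e he
    have h1 := hL _ hs'
    have h2 := hL _ (h.cross _ _ _ _ hrs hs' hr (by omega) hp).2
    omega

/-- An edge from `q` past `q + 1` and an edge from `q + 1` past `q` cross, which yields the edge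
between `q` and `q + 1`. If the neighbour at hand of `q + 1` lies before `q`, goodness of `q - 1`
supplies another by a crossing. -/
theorem adj_succ (h : Staircase P R) {q : ℕ} (hP : P (q + 1)) (hq : Good R q)
    (hq' : ∀ q', q' + 1 = q → Good R q') : R q (q + 1) := by
  obtain ⟨r, hr, hqr⟩ := hq
  have p1 := h.parity _ _ hqr
  rcases (show q + 1 ≤ r from hr).eq_or_lt with rfl | hr1
  · exact hqr
  have key : ∀ s, q ≤ s → R (q + 1) s → R q (q + 1) := by
    intro s hs hqs
    rcases hs.eq_or_lt with rfl | hs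
    · exact h.symm _ _ hqs
    · have := h.parity _ _ hqs
      exact (h.cross _ _ _ _ hqr (h.symm _ _ hqs) hs hr1 (by omega)).1
  obtain ⟨s, hs⟩ := h.nbr _ hP
  by_cases hsq : q ≤ s
  · exact key s hsq hs
  · obtain ⟨q', rfl⟩ : ∃ q', q = q' + 1 := ⟨q - 1, by omega⟩
    obtain ⟨t, ht, hqt⟩ := hq' q' rfl
    exact key t (by omega) (h.cross _ _ _ _ hqt hs (by omega) (by omega) (by omega)).2

/-- The side of `p` is downward closed; a later neighbour of `p - 2` lies at `p - 1` or beyond, so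
the other side reaches far enough too. -/
theorem present_of_lt (h : Staircase P R) {p : ℕ} (hp : P p)
    (hg : ∀ q, q < p → P q → Good R q) {q : ℕ} (hq : q < p) : P q := by
  by_cases hpar : (q + p) % 2 = 0
  · exact h.of_le hp hq.le hpar
  rcases Nat.lt_or_ge p 2 with hp2 | hp2
  · obtain ⟨r, hr⟩ := h.nbr p hp
    have := h.parity _ _ hr
    exact h.of_le (h.right hr) (by omega) (by omega)
  · obtain ⟨r, hr, hpr⟩ := hg (p - 2) (by omega) (h.of_le hp (by omega) (by omega))
    have := h.parity _ _ hpr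
    exact h.of_le (h.right hpr) (by omega) (by omega)

theorem adj_succ_of_lt (h : Staircase P R) {p : ℕ} (hp : P p)
    (hg : ∀ q, q < p → P q → Good R q) {q : ℕ} (hq : q < p) : R q (q + 1) := by
  have hP := fun q => h.present_of_lt hp hg (q := q)
  refine h.adj_succ ?_ (hg q hq (hP q hq)) fun q' hq' => hg q' (by omega) (hP _ (by omega))
  rcases (show q + 1 ≤ p from hq).eq_or_lt with rfl | h1
  · exact hp
  · exact hP _ h1

theorem good_zero (h : Staircase P R) (h0 : P 0) : Good R 0 := by
  obtain ⟨r, hr⟩ := h.nbr 0 h0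
  have := h.parity _ _ hr
  exact ⟨r, by omega, hr⟩

theorem lt_of_not_good (h : Staircase P R) {p r : ℕ} (hp : ¬ Good R p) (hr : R p r) : r < p := by
  have := h.parity _ _ hr
  by_contra! hlt
  exact hp ⟨r, by omega, hr⟩

theorem pos_of_not_good (h : Staircase P R) {p : ℕ} (hP : P p) (hp : ¬ Good R p) : 1 ≤ p := by
  rcases Nat.eq_zero_or_pos p with rfl | h0
  · exact (hp (h.good_zero hP)).elim
  · exact h0

/-! ### Dropping the first position without a later neighbour -/

section Remove

variable {p : ℕ}

/-- This is what makes `p` expendable: a neighbour `t` of `p` is also adjacent to `p - 2`, or, if `t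
= p - 1`, to `p + 2`, by crossing with a common neighbour of `p` and `p + 2`. -/
theorem exists_ne_of_adj (h : Staircase P R) (hP : P (p + 2)) (hg : ∀ q, q < p → P q → Good R q)
    (hp : ¬ Good R p) {t : ℕ} (ht : R p t) : ∃ r, r ≠ p ∧ t < r ∧ R t r := by
  have htp := h.lt_of_not_good hp ht
  have par := h.parity _ _ ht
  rcases Nat.lt_or_ge (t + 1) p with h1 | h1
  · have h2 : P (p - 2) := h.of_le hP (by omega) (by omega)
    obtain ⟨s, hs, hps⟩ := hg (p - 2) (by omega) h2
    have := h.parity _ _ hps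
    refine ⟨p - 2, by omega, by omega, h.symm _ _ ?_⟩
    exact (h.cross _ _ _ _ hps ht (by omega) (by omega) (by omega)).1
  · obtain rfl : p = t + 1 := by omega
    obtain ⟨s, hs, hs'⟩ := h.conn _ hP
    have hsp := h.lt_of_not_good hp hs
    refine ⟨t + 1 + 2, by omega, by omega, h.symm _ _ ?_⟩
    rcases (show s ≤ t by omega).eq_or_lt with rfl | hst
    · exact hs'
    · exact (h.cross _ _ _ _ ht hs' (by omega) hst (by omega)).2

theorem remove (h : Staircase P R) (hP : P (p + 2)) (hg : ∀ q, q < p → P q → Good R q)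
    (hp : ¬ Good R p) :
    Staircase (fun q => P (skip p q)) (fun q r => R (skip p q) (skip p r)) where
  down q hq := by
    refine h.of_le hq (skip_lt_skip (by omega) (by omega)).le ?_
    have := skip_parity p q
    have := skip_parity p (q + 2)
    omega
  left q r := h.left _ _
  symm q r := h.symm _ _
  parity q r hqr := by
    have := h.parity _ _ hqr
    have := skip_parity p q
    have := skip_parity p r
    omega
  cross q r q' r' hqr hqr' hq hr hpar := by
    have := h.parity _ _ hqr
    have := h.parity _ _ hqr'
    have := skip_parity p q
    have := skip_parity p r
    have := skip_parity p q'
    have := skip_parity p r'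
    exact h.cross _ _ _ _ hqr hqr' (skip_lt_skip hq hpar) (skip_lt_skip hr (by omega)) (by omega)
  nbr q hq := by
    obtain ⟨r, hr⟩ := h.nbr _ hq
    by_cases hrp : r = p
    · subst hrp
      obtain ⟨s, hs, -, hqs⟩ := h.exists_ne_of_adj hP hg hp (h.symm _ _ hr)
      obtain ⟨s, rfl⟩ := exists_skip_eq hs
      exact ⟨s, hqs⟩
    · obtain ⟨r, rfl⟩ := exists_skip_eq hrp
      exact ⟨r, hr⟩
  conn q hq := by
    have hPp := h.down _ hP
    by_cases hpar : (q + p) % 2 = 0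
    · by_cases hqp : q + 2 = p
      -- The entries on either side of the gap become consecutive. A common neighbour of `p` and `p
      -- + 2` also serves the entry before `p`, by crossing with a later neighbour of it.
      · subst hqp
        rw [skip_of_lt (q := q) (by omega), skip_of_even (by omega) le_rfl]
        obtain ⟨s, hs, hs'⟩ := h.conn _ hP
        have hlt := h.lt_of_not_good hp hs
        have par := h.parity _ _ hs
        refine ⟨s, ?_⟩
        rw [skip_of_odd par]
        refine ⟨?_, hs'⟩
        obtain ⟨t, ht, hqt⟩ := hg q (by omega) (h.down _ hPp)
        have := h.parity _ _ hqt
        rcases (show s ≤ t by omega).eq_or_lt with rfl | hst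
        · exact hqt
        · exact (h.cross _ _ _ _ hqt hs' (by omega) hst (by omega)).1
      · have e : skip p (q + 2) = skip p q + 2 := by unfold skip; split_ifs <;> omega
        rw [e] at hq ⊢
        obtain ⟨s, hs, hs'⟩ := h.conn _ hq
        have par := h.parity _ _ hs
        have := skip_parity p q
        refine ⟨s, ?_⟩
        rw [skip_of_odd (q := s) (by omega)]
        exact ⟨hs, hs'⟩
    · rw [skip_of_odd (q := q + 2) (by omega)] at hq ⊢
      rw [skip_of_odd (q := q) (by omega)]
      obtain ⟨s, hs, hs'⟩ := h.conn _ hq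
      by_cases hsp : s = p
      -- If the common neighbour was the dropped one, then `q + 1`, on its side and before it, takes
      -- over by two crossings.
      · subst hsp
        have hlt := h.lt_of_not_good hp (h.symm _ _ hs')
        have hPq : P (q + 1) := h.of_le hPp (by omega) (by omega)
        obtain ⟨t, ht, hqt⟩ := hg (q + 1) (by omega) hPq
        have par := h.parity _ _ hqt
        refine ⟨q + 1, ?_⟩
        rw [skip_of_lt (by omega)]
        have h1 := (h.cross _ _ _ _ hqt (h.symm _ _ hs) (by omega) (by omega) (by omega)).1
        refine ⟨h.symm _ _ h1, h.symm _ _ ?_⟩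
        rcases (show q + 2 ≤ t by omega).eq_or_lt with rfl | h2
        · exact hqt
        · exact (h.cross _ _ _ _ hqt (h.symm _ _ hs') (by omega) h2 (by omega)).1
      · obtain ⟨s, rfl⟩ := exists_skip_eq hsp
        exact ⟨s, hs, hs'⟩

theorem good_remove (h : Staircase P R) (hP : P (p + 2)) (hg : ∀ q, q < p → P q → Good R q)
    (hp : ¬ Good R p) {q : ℕ} (hq : q < p) :
    Good (fun q r => R (skip p q) (skip p r)) q := by
  have hPq := h.present_of_lt (h.down _ hP) hg hq
  obtain ⟨r, hr, hqr⟩ := hg q hq hPq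
  have key : ∀ r, r ≠ p → q < r → R q r → Good (fun q r => R (skip p q) (skip p r)) q := by
    intro r hrp hr hqr
    obtain ⟨s, rfl⟩ := exists_skip_eq hrp
    refine ⟨s, ?_, ?_⟩
    · by_contra! hs
      rw [skip_of_lt (by omega)] at hr
      omega
    · simpa only [skip_of_lt hq] using hqr
  by_cases hrp : r = p
  · subst hrp
    obtain ⟨s, hs, hqs, hadj⟩ := h.exists_ne_of_adj hP hg hp (h.symm _ _ hqr)
    exact key s hs hqs hadj
  · exact key r hrp hr hqr

end Remove

/-- If the last entry of its side has no later neighbour, then nothing comes after it. -/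
theorem le_of_last (h : Staircase P R) {p : ℕ} (hPp : P p) (hP : ¬ P (p + 2))
    (hp : ¬ Good R p) {q : ℕ} (hq : P q) : q ≤ p := by
  by_contra! hlt
  by_cases hpar : (q + p) % 2 = 0
  · exact hP (h.of_le hq (by omega) (by omega))
  · obtain ⟨r, hr⟩ := h.nbr q hq
    have par := h.parity _ _ hr
    have hrp : r ≤ p := by
      by_contra! hrp
      exact hP (h.of_le (h.right hr) (by omega) (by omega))
    have := h.nbr_le hPp (fun s hs => (h.lt_of_not_good hp hs).le) hrp (by omega) (h.symm _ _ hr)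
    omega

end Staircase

end BipPermMIST

/-! ### Placing the remaining vertices of a graph at positions -/

namespace BipPermMIST

variable {V : Type*}

/-- Adjacency of positions. -/
def posAdj (G : SimpleGraph V) (P : ℕ → Prop) (c : ℕ → V) (q r : ℕ) : Prop :=
  P q ∧ P r ∧ G.Adj (c q) (c r)

/-- The remaining vertices are placed at the positions `P` by `c`, in a strong ordering; `χ` is
the `2`-colouring of `G` that agrees with the parity of the positions. -/
structure Layout (G : SimpleGraph V) (χ : V → ℕ) (P : ℕ → Prop) (c : ℕ → V) : Prop where
  stair : Staircase P (posAdj G P c)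
  inj : ∀ q r, P q → P r → c q = c r → q = r
  color : ∀ q, P q → χ (c q) = q % 2
  color_ne : ∀ u v, G.Adj u v → χ u ≠ χ v

/-- All positions before `p` have a later neighbour, but `p` does not. -/
structure Event (G : SimpleGraph V) (P : ℕ → Prop) (c : ℕ → V) (p : ℕ) : Prop where
  present : P p
  good : ∀ q, q < p → P q → Good (posAdj G P c) q
  not_good : ¬ Good (posAdj G P c) p

section

variable {G : SimpleGraph V} {χ : V → ℕ} {P : ℕ → Prop} {c : ℕ → V} {p : ℕ}

theorem Layout.remove (h : Layout G χ P c) (hE : Event G P c p) (hP : P (p + 2)) :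
    Layout G χ (fun q => P (skip p q)) (fun q => c (skip p q)) where
  stair := h.stair.remove hP hE.good hE.not_good
  inj _ _ hq hr hqr := skip_injective p (h.inj _ _ hq hr hqr)
  color q hq := (h.color _ hq).trans (skip_parity p q)
  color_ne := h.color_ne

theorem Layout.good_remove (h : Layout G χ P c) (hE : Event G P c p) (hP : P (p + 2)) {q : ℕ}
    (hq : q < p) : Good (posAdj G (fun q => P (skip p q)) (fun q => c (skip p q))) q :=
  h.stair.good_remove hP hE.good hE.not_good hq

theorem Event.pos (hE : Event G P c p) (h : Layout G χ P c) : 1 ≤ p :=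
  h.stair.pos_of_not_good hE.present hE.not_good

theorem Event.adj_succ (hE : Event G P c p) (h : Layout G χ P c) {q : ℕ} (hq : q < p) :
    P q ∧ P (q + 1) ∧ G.Adj (c q) (c (q + 1)) :=
  h.stair.adj_succ_of_lt hE.present hE.good hq

theorem Event.present_of_le (hE : Event G P c p) (h : Layout G χ P c) {q : ℕ} (hq : q ≤ p) :
    P q := by
  rcases hq.eq_or_lt with rfl | hq
  · exact hE.present
  · exact (hE.adj_succ h hq).1

theorem Event.nbr_lt (hE : Event G P c p) (h : Layout G χ P c) {q r : ℕ} (hq : q ≤ p)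
    (hpar : (q + p) % 2 = 0) (hr : P r) (hadj : G.Adj (c q) (c r)) : r < p := by
  have hp := hE.pos h
  have := h.stair.nbr_le (L := p - 1) hE.present
    (fun s hs => by have := h.stair.lt_of_not_good hE.not_good hs; omega) hq hpar
    ⟨hE.present_of_le h hq, hr, hadj⟩
  omega

theorem Layout.parity (h : Layout G χ P c) {q r : ℕ} (hq : P q) (hr : P r)
    (hadj : G.Adj (c q) (c r)) : (q + r) % 2 = 1 := h.stair.parity _ _ ⟨hq, hr, hadj⟩

end

/-! ### Certificates for the number of leaves -/

/-- A lower bound on the number of leaves: `S` contains at least `m` leaves of each spanning tree,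
and the independent set `A` outside `S` has all its neighbours in `B`. The positions from `l` on
are not used by the certificate yet. -/
structure Cert (G : SimpleGraph V) (χ : V → ℕ) (P : ℕ → Prop) (c : ℕ → V) (l t k : ℕ)
    (S : Set V) (m : ℕ) (A B : Finset V) : Prop where
  bound : LeafBound G S m
  disj : Disjoint S A
  count : k + B.card ≤ m + A.card
  nbrs : ∀ u ∈ A, ∀ v, G.Adj u v → v ∈ B
  color : ∀ u ∈ A, χ u = t % 2
  mem_B : ∀ v ∈ B, ∃ r < l, P r ∧ (r + t) % 2 = 1 ∧ c r = v
  notMem_S : ∀ q, l ≤ q → P q → c q ∉ S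
  notMem_A : ∀ q, l ≤ q → P q → c q ∉ A
  opp : ∀ q, l ≤ q → P q → (q + t) % 2 = 1 → ∀ v, G.Adj (c q) v → ∃ r, l ≤ r ∧ P r ∧ c r = v
  same : ∀ q, l ≤ q → P q → (q + t) % 2 = 0 → ∀ v, G.Adj (c q) v →
    v ∈ B ∨ ∃ r, l ≤ r ∧ P r ∧ c r = v

namespace Cert

variable {G : SimpleGraph V} {χ : V → ℕ} {P : ℕ → Prop} {c : ℕ → V}
  {p l t k m : ℕ} {S : Set V} {A B : Finset V}

/-- The bound concerns all of `G`, so it survives the removal. Position `p` is already used up; the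
entry at `p + 2` slides to `p` and the one at `p + 1` stays, so the unused positions now begin at
`p`. -/
theorem remove (h : Cert G χ P c (p + 1) p k S m A B) :
    Cert G χ (fun q => P (skip p q)) (fun q => c (skip p q)) p p k S m A B where
  bound := h.bound
  disj := h.disj
  count := h.count
  nbrs := h.nbrs
  color := h.color
  mem_B v hv := by
    obtain ⟨r, hr, hPr, hpar, hc⟩ := h.mem_B v hv
    have : skip p r = r := skip_of_odd (by omega)
    exact ⟨r, by omega, by rwa [this], hpar, by rwa [this]⟩
  notMem_S q hq := h.notMem_S _ (lt_skip hq)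
  notMem_A q hq := h.notMem_A _ (lt_skip hq)
  opp q hq hP hpar v hv := by
    have := skip_parity p q
    obtain ⟨r, hr, hPr, hc⟩ := h.opp _ (lt_skip hq) hP (by omega) v hv
    obtain ⟨r, rfl⟩ := exists_skip_eq (p := p) (s := r) (by omega)
    refine ⟨r, ?_, hPr, hc⟩
    by_contra! hlt
    rw [skip_of_lt hlt] at hr
    omega
  same q hq hP hpar v hv := by
    have := skip_parity p q
    refine (h.same _ (lt_skip hq) hP (by omega) v hv).imp_right ?_
    rintro ⟨r, hr, hPr, hc⟩
    obtain ⟨r, rfl⟩ := exists_skip_eq (p := p) (s := r) (by omega)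
    refine ⟨r, ?_, hPr, hc⟩
    by_contra! hlt
    rw [skip_of_lt hlt] at hr
    omega

theorem leafBound_A [Fintype V] [Nontrivial V] (h : Cert G χ P c l t k S m A B) (hL : Layout G χ P c)
    (hA : A.Nonempty) : LeafBound G A (A.card + 1 - B.card) :=
  leafBound_of_neighbors hA
    (fun u hu v hv huv => hL.color_ne u v huv ((h.color u hu).trans (h.color v hv).symm)) h.nbrs

theorem leafBound [Fintype V] [Nontrivial V] (h : Cert G χ P c l t k S m A B) (hL : Layout G χ P c)
    (hA : A.Nonempty) : LeafBound G (S ∪ A) (k + 1) :=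
  (h.bound.union (h.leafBound_A hL hA) h.disj).mono subset_rfl (by have := h.count; omega)

/-- The vertices at positions `a, a + 2, …, a + 2 (j - 1)`. -/
def block [DecidableEq V] (c : ℕ → V) (a j : ℕ) : Finset V :=
  (Finset.range j).image fun i => c (a + 2 * i)

theorem mem_block [DecidableEq V] {a j : ℕ} {v : V} :
    v ∈ block c a j ↔ ∃ i < j, c (a + 2 * i) = v := by
  simp [block]

theorem card_block_le [DecidableEq V] (c : ℕ → V) (a j : ℕ) : (block c a j).card ≤ j :=
  Finset.card_image_le.trans (by simp)

theorem card_block [DecidableEq V] (hL : Layout G χ P c) {a j : ℕ}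
    (hP : ∀ i < j, P (a + 2 * i)) : (block c a j).card = j := by
  rw [block, Finset.card_image_of_injOn, Finset.card_range]
  intro i hi i' hi' h
  have := hL.inj _ _ (hP i (by simpa using hi)) (hP i' (by simpa using hi')) h
  omega

/-- Positions `t, t + 2, …, p` join `A` and the positions strictly between them join `B`, one fewer.
Nothing else is adjacent to the new part of `A`, because no vertex on the side of `p` up to `p` has
a neighbour past `p`. -/
theorem extend_same (h : Cert G χ P c t t k S m A B) (hL : Layout G χ P c)
    (hE : Event G P c p) (ht : t ≤ p) (hpar : (p + t) % 2 = 0) :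
    ∃ A' B', A'.Nonempty ∧ Cert G χ P c (p + 1) p (k + 1) S m A' B' := by
  classical
  obtain ⟨j, rfl⟩ : ∃ j, p = t + 2 * j := ⟨(p - t) / 2, by omega⟩
  have hP : ∀ q ≤ t + 2 * j, P q := fun q hq => hE.present_of_le hL hq
  have hdisj : Disjoint A (block c t (j + 1)) := by
    rw [Finset.disjoint_left]
    intro v hv hv'
    obtain ⟨i, hi, rfl⟩ := mem_block.1 hv'
    exact h.notMem_A _ (by omega) (hP _ (by omega)) hv
  refine ⟨A ∪ block c t (j + 1), B ∪ block c (t + 1) j,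
    ⟨c t, Finset.mem_union_right _ (mem_block.2 ⟨0, by omega, by simp⟩)⟩, ?_⟩
  refine ⟨h.bound, ?_, ?_, ?_, ?_, ?_, ?_, ?_, ?_, ?_⟩
  · rw [Set.disjoint_right]
    intro v hv hS
    rw [Finset.mem_coe, Finset.mem_union, mem_block] at hv
    rcases hv with hv | ⟨i, hi, rfl⟩
    · exact Set.disjoint_left.1 h.disj hS hv
    · exact h.notMem_S _ (by omega) (hP _ (by omega)) hS
  · rw [Finset.card_union_of_disjoint hdisj, card_block hL fun i hi => hP _ (by omega)]
    have := Finset.card_union_le B (block c (t + 1) j)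
    have := card_block_le c (t + 1) j
    have := h.count
    omega
  · intro u hu v huv
    rw [Finset.mem_union, mem_block] at hu ⊢
    rcases hu with hu | ⟨i, hi, rfl⟩
    · exact Or.inl (h.nbrs u hu v huv)
    · refine (h.same _ (by omega) (hP _ (by omega)) (by omega) v huv).imp_right ?_
      rintro ⟨r, hr, hPr, rfl⟩
      have := hE.nbr_lt hL (by omega) (by omega) hPr huv
      have := hL.parity (hP _ (by omega)) hPr huv
      exact ⟨(r - t - 1) / 2, by omega, by congr 1; omega⟩
  · intro u hu
    rw [Finset.mem_union, mem_block] at hu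
    rcases hu with hu | ⟨i, hi, rfl⟩
    · rw [h.color u hu]; omega
    · rw [hL.color _ (hP _ (by omega))]; omega
  · intro v hv
    rw [Finset.mem_union, mem_block] at hv
    rcases hv with hv | ⟨i, hi, rfl⟩
    · obtain ⟨r, hr, hPr, hrt, rfl⟩ := h.mem_B v hv
      exact ⟨r, by omega, hPr, by omega, rfl⟩
    · exact ⟨_, by omega, hP _ (by omega), by omega, rfl⟩
  · intro q hq
    exact h.notMem_S q (by omega)
  · intro q hq hPq hmem
    rw [Finset.mem_union, mem_block] at hmem
    rcases hmem with hmem | ⟨i, hi, hc⟩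
    · exact h.notMem_A q (by omega) hPq hmem
    · have := hL.inj _ _ (hP _ (by omega)) hPq hc
      omega
  · intro q hq hPq hqp v hv
    obtain ⟨r, hr, hPr, rfl⟩ := h.opp q (by omega) hPq (by omega) v hv
    refine ⟨r, ?_, hPr, rfl⟩
    by_contra! hlt
    have := hL.parity hPq hPr hv
    have := hE.nbr_lt hL (q := r) (by omega) (by omega) hPq hv.symm
    omega
  · intro q hq hPq hqp v hv
    rw [Finset.mem_union, mem_block]
    rcases h.same q (by omega) hPq (by omega) v hv with hB | ⟨r, hr, hPr, rfl⟩
    · exact Or.inl (Or.inl hB)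
    · have := hL.parity hPq hPr hv
      by_cases hrp : t + 2 * j + 1 ≤ r
      · exact Or.inr ⟨r, hrp, hPr, rfl⟩
      · exact Or.inl (Or.inr ⟨(r - t - 1) / 2, by omega, by congr 1; omega⟩)

/-- Settling `A` yields `k + 1` leaves, exactly the new target, so the new pair need only be
balanced: `t + 1, t + 3, …, p` against `t, t + 2, …, p - 1`. The old `B` is on the side of the new
`A` but disappears from the certificate. -/
theorem extend_opp [Fintype V] [Nontrivial V] (h : Cert G χ P c t t k S m A B) (hL : Layout G χ P c)
    (hE : Event G P c p) (ht : t ≤ p) (hpar : (p + t) % 2 = 1) (hA : A.Nonempty) :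
    ∃ A' B', A'.Nonempty ∧ Cert G χ P c (p + 1) p (k + 1) (S ∪ A) (k + 1) A' B' := by
  classical
  obtain ⟨j, rfl⟩ : ∃ j, p = t + 1 + 2 * j := ⟨(p - t) / 2, by omega⟩
  have hP : ∀ q ≤ t + 1 + 2 * j, P q := fun q hq => hE.present_of_le hL hq
  refine ⟨block c (t + 1) (j + 1), block c t (j + 1),
    ⟨c (t + 1), mem_block.2 ⟨0, by omega, by simp⟩⟩, ?_⟩
  refine ⟨h.leafBound hL hA, ?_, ?_, ?_, ?_, ?_, ?_, ?_, ?_, ?_⟩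
  · rw [Set.disjoint_right]
    intro v hv hS
    rw [Finset.mem_coe, mem_block] at hv
    obtain ⟨i, hi, rfl⟩ := hv
    rcases hS with hS | hS
    · exact h.notMem_S _ (by omega) (hP _ (by omega)) hS
    · exact h.notMem_A _ (by omega) (hP _ (by omega)) hS
  · rw [card_block hL fun i hi => hP _ (by omega), card_block hL fun i hi => hP _ (by omega)]
  · intro u hu v huv
    rw [mem_block] at hu ⊢
    obtain ⟨i, hi, rfl⟩ := hu
    obtain ⟨r, hr, hPr, rfl⟩ := h.opp _ (by omega) (hP _ (by omega)) (by omega) v huv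
    have := hE.nbr_lt hL (by omega) (by omega) hPr huv
    have := hL.parity (hP _ (by omega)) hPr huv
    exact ⟨(r - t) / 2, by omega, by congr 1; omega⟩
  · intro u hu
    rw [mem_block] at hu
    obtain ⟨i, hi, rfl⟩ := hu
    rw [hL.color _ (hP _ (by omega))]; omega
  · intro v hv
    rw [mem_block] at hv
    obtain ⟨i, hi, rfl⟩ := hv
    exact ⟨_, by omega, hP _ (by omega), by omega, rfl⟩
  · rintro q hq hPq (hS | hS)
    · exact h.notMem_S q (by omega) hPq hS
    · exact h.notMem_A q (by omega) hPq hS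
  · intro q hq hPq hmem
    rw [mem_block] at hmem
    obtain ⟨i, hi, hc⟩ := hmem
    have := hL.inj _ _ (hP _ (by omega)) hPq hc
    omega
  · intro q hq hPq hqp v hv
    -- A neighbour at or before `p` would be on the side of `p` and so have no neighbour beyond `p`;
    -- in particular the members of `B` are excluded.
    have key : ∀ r, P r → c r = v → t + 1 + 2 * j + 1 ≤ r := by
      rintro r hPr rfl
      by_contra! hlt
      have := hL.parity hPq hPr hv
      have := hE.nbr_lt hL (q := r) (by omega) (by omega) hPq hv.symm
      omega
    rcases h.same q (by omega) hPq (by omega) v hv with hB | ⟨r, hr, hPr, hc⟩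
    · obtain ⟨r, hr, hPr, -, hc⟩ := h.mem_B v hB
      exact ⟨r, key r hPr hc, hPr, hc⟩
    · exact ⟨r, key r hPr hc, hPr, hc⟩
  · intro q hq hPq hqp v hv
    rw [mem_block]
    obtain ⟨r, hr, hPr, rfl⟩ := h.opp q (by omega) hPq (by omega) v hv
    have := hL.parity hPq hPr hv
    by_cases hrp : t + 1 + 2 * j + 1 ≤ r
    · exact Or.inr ⟨r, hrp, hPr, rfl⟩
    · exact Or.inl ⟨(r - t) / 2, by omega, by congr 1; omega⟩

theorem extend [Fintype V] [Nontrivial V] (h : Cert G χ P c t t k S m A B) (hL : Layout G χ P c)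
    (hE : Event G P c p) (ht : t ≤ p) (hA : A.Nonempty ∨ (p + t) % 2 = 0) :
    ∃ S' m' A' B', A'.Nonempty ∧ Cert G χ P c (p + 1) p (k + 1) S' m' A' B' := by
  by_cases hpar : (p + t) % 2 = 0
  · exact ⟨_, _, h.extend_same hL hE ht hpar⟩
  · exact ⟨_, _, h.extend_opp hL hE ht (by omega) (hA.resolve_right hpar)⟩

/-- The trivial certificate. -/
theorem start (hc : ∀ v, ∃ q, P q ∧ c q = v) : Cert G χ P c 0 0 0 ∅ 0 ∅ ∅ := by
  have h := fun v => let ⟨q, hq⟩ := hc v; (⟨q, Nat.zero_le q, hq⟩ : ∃ q, 0 ≤ q ∧ P q ∧ c q = v)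
  exact ⟨fun _ _ => Nat.zero_le _, by simp, by simp, by simp, by simp, by simp, by simp, by simp,
    fun _ _ _ _ v _ => h v, fun _ _ _ _ v _ => Or.inr (h v)⟩

/-- The certificate for a leaf among the vertices at the even positions up to `e`, if their
neighbours are at positions up to `e + 1`. -/
theorem of_wall (hc : ∀ v, ∃ q, P q ∧ c q = v) (hL : Layout G χ P c) {e : ℕ} (he : P e)
    (hev : e % 2 = 0) (hw : ∀ r, P r → G.Adj (c e) (c r) → r ≤ e + 1) :
    ∃ A B, A.Nonempty ∧ Cert G χ P c (e + 2) (e + 2) 0 ∅ 0 A B := by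
  classical
  have hw' : ∀ q r, q ≤ e → q % 2 = 0 → P q → P r → G.Adj (c q) (c r) → r ≤ e + 1 :=
    fun q r hq hq2 hPq hPr hadj => hL.stair.nbr_le he (fun s hs => hw s hs.2.1 hs.2.2) hq
      (by omega) ⟨hPq, hPr, hadj⟩
  obtain ⟨j, rfl⟩ : ∃ j, e = 2 * j := ⟨e / 2, by omega⟩
  have hP : ∀ i < j + 1, P (0 + 2 * i) := fun i hi => hL.stair.of_le he (by omega) (by omega)
  -- The filter is needed because position `e + 1` may be unoccupied; only the upper bound on the
  -- size of `B` matters.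
  refine ⟨block c 0 (j + 1), (block c 1 (j + 1)).filter fun v => ∃ q, P q ∧ q % 2 = 1 ∧
    q < 2 * j + 2 ∧ c q = v, ⟨c 0, mem_block.2 ⟨0, by omega, by simp⟩⟩, ?_⟩
  refine ⟨fun _ _ => Nat.zero_le _, by simp, ?_, ?_, ?_, ?_, by simp, ?_, ?_, ?_⟩
  · rw [card_block hL hP]
    have := Finset.card_filter_le (block c 1 (j + 1)) fun v => ∃ q, P q ∧ q % 2 = 1 ∧
      q < 2 * j + 2 ∧ c q = v
    have := card_block_le c 1 (j + 1)
    omega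
  · intro u hu v huv
    rw [mem_block] at hu
    obtain ⟨i, hi, rfl⟩ := hu
    obtain ⟨r, hr, rfl⟩ := hc v
    have := hL.parity (hP i hi) hr huv
    have := hw' _ r (by omega) (by omega) (hP i hi) hr huv
    rw [Finset.mem_filter, mem_block]
    exact ⟨⟨(r - 1) / 2, by omega, by congr 1; omega⟩, r, hr, by omega, by omega, rfl⟩
  · intro u hu
    rw [mem_block] at hu
    obtain ⟨i, hi, rfl⟩ := hu
    rw [hL.color _ (hP i hi)]; omega
  · intro v hv
    rw [Finset.mem_filter] at hv
    obtain ⟨-, q, hq, hq2, hlt, rfl⟩ := hv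
    exact ⟨q, hlt, hq, by omega, rfl⟩
  · intro q hq hPq hmem
    rw [mem_block] at hmem
    obtain ⟨i, hi, hci⟩ := hmem
    have := hL.inj _ _ (hP i hi) hPq hci
    omega
  · intro q hq hPq hqp v hv
    obtain ⟨r, hr, rfl⟩ := hc v
    refine ⟨r, ?_, hr, rfl⟩
    by_contra! hlt
    have := hL.parity hPq hr hv
    have := hw' r q (by omega) (by omega) hr hPq hv.symm
    omega
  · intro q hq hPq hqp v hv
    obtain ⟨r, hr, rfl⟩ := hc v
    have := hL.parity hPq hr hv
    by_cases hlt : 2 * j + 2 ≤ r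
    · exact Or.inr ⟨r, hlt, hr, rfl⟩
    · left
      rw [Finset.mem_filter, mem_block]
      exact ⟨⟨(r - 1) / 2, by omega, by congr 1; omega⟩, r, hr, by omega, by omega, rfl⟩

end Cert

end BipPermMIST

namespace BipPermMIST

variable {V : Type*}

/-! ### The tree built by the algorithm -/

/-- The edges of the path through the positions `0, …, p`. -/
def pathEdges [DecidableEq V] (c : ℕ → V) (p : ℕ) : Finset (Sym2 V) :=
  (Finset.range p).image fun q => s(c q, c (q + 1))

/-- The edges `E` attach the removed vertices `D` to the vertices at the positions `P`. -/
structure Attached (G : SimpleGraph V) (P : ℕ → Prop) (c : ℕ → V) (E : Finset (Sym2 V))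
    (D : Finset V) : Prop where
  sub : ∀ e ∈ E, e ∈ G.edgeSet
  card : E.card ≤ D.card
  cover : ∀ v, v ∈ D ∨ ∃ q, P q ∧ c q = v
  notMem : ∀ q, P q → c q ∉ D
  reach : ∀ v, ∃ q, P q ∧ (SimpleGraph.fromEdgeSet (E : Set (Sym2 V))).Reachable v (c q)

/-- Needed for the Hamiltonian path, the one outcome that no certificate covers. -/
theorem leafBound_two [Fintype V] [Nontrivial V] (G : SimpleGraph V) :
    LeafBound G Set.univ 2 := by
  classical
  intro T hT
  obtain ⟨u, v, huv, hu, hv⟩ := hT.2.exists_ne_and_degree_eq_one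
  have hdeg : ∀ w, T.degree w = 1 → ¬ 2 ≤ (T.neighborSet w).ncard := by
    intro w hw
    rw [Set.ncard_eq_toFinset_card', ← SimpleGraph.neighborFinset_def,
      SimpleGraph.card_neighborFinset_eq_degree, hw]
    omega
  refine (Set.ncard_pair huv).symm.le.trans (Set.ncard_le_ncard ?_)
  rintro w (rfl | rfl)
  · exact ⟨trivial, hdeg _ hu⟩
  · exact ⟨trivial, hdeg _ hv⟩

namespace Attached

variable {G : SimpleGraph V} {χ : V → ℕ} {P : ℕ → Prop} {c : ℕ → V} {p : ℕ}
  {E : Finset (Sym2 V)} {D : Finset V}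

theorem start [Nonempty V] (hc : ∀ v, ∃ q, P q ∧ c q = v) : Attached G P c ∅ ∅ where
  sub := by simp
  card := by simp
  cover v := Or.inr (hc v)
  notMem := by simp
  reach v := by
    obtain ⟨q, hq, rfl⟩ := hc v
    exact ⟨q, hq, SimpleGraph.Reachable.refl _⟩

theorem remove [DecidableEq V] (h : Attached G P c E D) (hL : Layout G χ P c)
    (hE : Event G P c p) :
    Attached G (fun q => P (skip p q)) (fun q => c (skip p q))
      (insert s(c (p - 1), c p) E) (insert (c p) D) := by
  have hp := hE.pos hL
  obtain ⟨hP1, -, hadj⟩ := hE.adj_succ hL (q := p - 1) (by omega)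
  rw [Nat.sub_add_cancel hp] at hadj
  refine ⟨?_, ?_, ?_, ?_, ?_⟩
  · intro e he
    rw [Finset.mem_insert] at he
    rcases he with rfl | he
    · exact hadj
    · exact h.sub e he
  · rw [Finset.card_insert_of_notMem (h.notMem p hE.present)]
    have := Finset.card_insert_le s(c (p - 1), c p) E
    have := h.card
    omega
  · intro v
    rcases h.cover v with hv | ⟨q, hq, rfl⟩
    · exact Or.inl (Finset.mem_insert_of_mem hv)
    · by_cases hqp : q = p
      · subst hqp
        exact Or.inl (Finset.mem_insert_self _ _)
      · obtain ⟨q, rfl⟩ := exists_skip_eq hqp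
        exact Or.inr ⟨q, hq, rfl⟩
  · intro q hq hmem
    rw [Finset.mem_insert] at hmem
    rcases hmem with hc | hmem
    · exact skip_ne p q (hL.inj _ _ hq hE.present hc)
    · exact h.notMem _ hq hmem
  · intro v
    have hle : SimpleGraph.fromEdgeSet (E : Set (Sym2 V)) ≤
        SimpleGraph.fromEdgeSet (insert s(c (p - 1), c p) E : Finset (Sym2 V)) :=
      SimpleGraph.fromEdgeSet_mono (by simp)
    obtain ⟨q, hq, hr⟩ := h.reach v
    -- Whatever hung on the vertex at `p` is rerouted to `p - 1` through the new edge.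
    by_cases hqp : q = p
    · subst hqp
      refine ⟨q - 1, ?_, ?_⟩
      · rwa [skip_of_lt (by omega)]
      · rw [skip_of_lt (by omega)]
        refine (hr.mono hle).trans (SimpleGraph.Adj.reachable ?_)
        rw [SimpleGraph.fromEdgeSet_adj]
        exact ⟨by simp [Sym2.eq_swap], hadj.ne'⟩
    · obtain ⟨q, rfl⟩ := exists_skip_eq hqp
      exact ⟨q, hq, hr.mono hle⟩

/-- There are `|D| + p + 1` vertices and at most `|D| + p` edges, so connectedness already makes a
tree. Every position other than `0` and `p` has two neighbours on the path. -/
theorem finish [Fintype V] [DecidableEq V] (h : Attached G P c E D) (hL : Layout G χ P c)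
    (hE : Event G P c p) (hP : ¬ P (p + 2)) (hb : LeafBound G Set.univ (D.card + 2)) :
    ∃ T : SimpleGraph V, ((E ∪ pathEdges c p : Finset (Sym2 V)) : Set (Sym2 V)) = T.edgeSet ∧
      IsMIST G T := by
  set F : Finset (Sym2 V) := E ∪ pathEdges c p with hF
  have hFG : ∀ e ∈ F, e ∈ G.edgeSet := by
    intro e he
    rw [hF, Finset.mem_union, pathEdges, Finset.mem_image] at he
    rcases he with he | ⟨q, hq, rfl⟩
    · exact h.sub e he
    · exact (hE.adj_succ hL (by simpa using hq)).2.2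
  have hes : (SimpleGraph.fromEdgeSet (F : Set (Sym2 V))).edgeSet = F := by
    rw [SimpleGraph.edgeSet_fromEdgeSet, sdiff_eq_left, Set.disjoint_left]
    intro e he hd
    exact G.not_isDiag_of_mem_edgeSet (hFG e he) hd
  have hpath : ∀ q < p, (SimpleGraph.fromEdgeSet (F : Set (Sym2 V))).Adj (c q) (c (q + 1)) := by
    intro q hq
    rw [SimpleGraph.fromEdgeSet_adj]
    refine ⟨?_, (hE.adj_succ hL hq).2.2.ne⟩
    rw [Finset.mem_coe, hF, Finset.mem_union, pathEdges, Finset.mem_image]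
    exact Or.inr ⟨q, by simpa using hq, rfl⟩
  have hle : ∀ q, P q → q ≤ p := fun q => hL.stair.le_of_last hE.present hP hE.not_good
  have hreach0 : ∀ q ≤ p, (SimpleGraph.fromEdgeSet (F : Set (Sym2 V))).Reachable (c q) (c 0) := by
    intro q hq
    induction q with
    | zero => exact SimpleGraph.Reachable.refl _
    | succ q ih => exact (hpath q (by omega)).symm.reachable.trans (ih (by omega))
  have hconn : (SimpleGraph.fromEdgeSet (F : Set (Sym2 V))).Connected := by
    have hr : ∀ v, (SimpleGraph.fromEdgeSet (F : Set (Sym2 V))).Reachable v (c 0) := by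
      intro v
      obtain ⟨q, hq, hr⟩ := h.reach v
      refine (hr.mono (SimpleGraph.fromEdgeSet_mono ?_)).trans (hreach0 q (hle q hq))
      simp [hF]
    have : Nonempty V := ⟨c 0⟩
    exact ⟨fun u v => (hr u).trans (hr v).symm⟩
  have hinj : Set.InjOn c (Finset.range (p + 1)) := by
    intro q hq r hr hqr
    simp only [Finset.coe_range, Set.mem_Iio] at hq hr
    exact hL.inj _ _ (hE.present_of_le hL (by omega)) (hE.present_of_le hL (by omega)) hqr
  have huniv : (Finset.univ : Finset V) = D ∪ (Finset.range (p + 1)).image c := by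
    ext v
    simp only [Finset.mem_univ, Finset.mem_union, Finset.mem_image, Finset.mem_range, true_iff]
    refine (h.cover v).imp_right ?_
    rintro ⟨q, hq, rfl⟩
    exact ⟨q, by have := hle q hq; omega, rfl⟩
  have hV : Nat.card V = D.card + (p + 1) := by
    rw [Nat.card_eq_fintype_card, ← Finset.card_univ, huniv, Finset.card_union_of_disjoint,
      Finset.card_image_of_injOn hinj, Finset.card_range]
    rw [Finset.disjoint_right]
    intro v hv
    obtain ⟨q, hq, rfl⟩ := Finset.mem_image.1 hv
    exact h.notMem q (hE.present_of_le hL (by simpa [Nat.lt_succ_iff] using hq))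
  have hFc : F.card ≤ D.card + p := by
    have h1 : F.card ≤ _ := Finset.card_union_le E (pathEdges c p)
    have h2 : (pathEdges c p).card ≤ p := Finset.card_image_le.trans (by simp)
    have h3 := h.card
    omega
  have hFe : Nat.card (SimpleGraph.fromEdgeSet (F : Set (Sym2 V))).edgeSet = F.card := by
    rw [hes, Nat.card_coe_set_eq, Set.ncard_coe_finset]
  have hcard := hconn.card_vert_le_card_edgeSet_add_one
  have hT : IsSpanningTree G (SimpleGraph.fromEdgeSet (F : Set (Sym2 V))) := by
    refine ⟨?_, ?_⟩
    · intro u v huv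
      rw [SimpleGraph.fromEdgeSet_adj] at huv
      exact hFG _ huv.1
    · rw [SimpleGraph.isTree_iff_connected_and_card]
      exact ⟨hconn, by omega⟩
  refine ⟨_, hes.symm, isMIST_of_leafBound hT hb ?_⟩
  have hsub : {v : V | ¬ 2 ≤ ((SimpleGraph.fromEdgeSet (F : Set (Sym2 V))).neighborSet v).ncard} ⊆
      ((D ∪ {c 0, c p} : Finset V) : Set V) := by
    intro v hv
    by_contra hn
    simp only [Finset.coe_union, Finset.coe_insert, Finset.coe_singleton, Set.mem_union,
      Finset.mem_coe, Set.mem_insert_iff, Set.mem_singleton_iff, not_or] at hn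
    obtain ⟨q, hq, rfl⟩ := (h.cover v).resolve_left hn.1
    have h0 : q ≠ 0 := fun h0 => hn.2.1 (by rw [h0])
    have h1 : q ≠ p := fun h0 => hn.2.2 (by rw [h0])
    have hqp := hle q hq
    apply hv
    have hne : c (q - 1) ≠ c (q + 1) := by
      intro hc
      have := hL.inj _ _ (hE.present_of_le hL (by omega)) (hE.present_of_le hL (by omega)) hc
      omega
    rw [← Set.ncard_pair hne]
    refine Set.ncard_le_ncard ?_
    rintro w (rfl | rfl)
    · have := hpath (q - 1) (by omega)
      rw [Nat.sub_add_cancel (by omega)] at this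
      exact this.symm
    · exact hpath q (by omega)
  refine (Set.ncard_le_ncard hsub).trans ?_
  rw [Set.ncard_coe_finset]
  exact (Finset.card_union_le _ _).trans (Nat.add_le_add_left Finset.card_le_two _)

end Attached

end BipPermMIST

namespace BipPermMIST

variable {V : Type*}

/-! ### Positions in a state of the algorithm -/

/-- The sequence `a 1, b 1, a 2, b 2, …`, counted from `0`. -/
def interleave (a b : ℕ → V) (q : ℕ) : V := if q % 2 = 0 then a (q / 2 + 1) else b (q / 2 + 1)

/-- The positions in `interleave a b` of `a 1, …, a m` and `b 1, …, b n`. -/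
def occupied (m n q : ℕ) : Prop := if q % 2 = 0 then q / 2 < m else q / 2 < n

/-! ### From a strong ordering to a layout of positions -/

section Initial

variable {G : SimpleGraph V} {n₁ n₂ : ℕ} {x y : ℕ → V}

theorem IsBipartitionEnumeration.symm (h : IsBipartitionEnumeration G n₁ n₂ x y) :
    IsBipartitionEnumeration G n₂ n₁ y x :=
  ⟨h.injOn_y, h.injOn_x, by rw [Set.union_comm]; exact h.cover, h.bipartite.symm⟩

theorem IsStrongOrdering.symm (h : IsStrongOrdering G n₁ n₂ x y) :
    IsStrongOrdering G n₂ n₁ y x := fun j hj j' hj' i hi i' hi' hadj hadj' hjj hii =>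
  have := h i' hi' i hi j' hj' j hj hadj'.symm hadj.symm hii hjj
  ⟨this.1.symm, this.2.symm⟩

theorem interleave_even (a b : ℕ → V) {q : ℕ} (h : q % 2 = 0) :
    interleave a b q = a (q / 2 + 1) := if_pos h

theorem interleave_odd (a b : ℕ → V) {q : ℕ} (h : q % 2 = 1) :
    interleave a b q = b (q / 2 + 1) := if_neg (by omega)

theorem occupied_even {m n q : ℕ} (h : q % 2 = 0) : occupied m n q ↔ q / 2 < m := by
  simp [occupied, h]

theorem occupied_odd {m n q : ℕ} (h : q % 2 = 1) : occupied m n q ↔ q / 2 < n := by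
  simp [occupied, h]

theorem exists_occupied (h : IsBipartitionEnumeration G n₁ n₂ x y) (v : V) :
    ∃ q, occupied n₁ n₂ q ∧ interleave x y q = v := by
  have hv : v ∈ x '' Set.Icc 1 n₁ ∪ y '' Set.Icc 1 n₂ := by rw [h.cover]; trivial
  rcases hv with ⟨i, ⟨hi, hi'⟩, rfl⟩ | ⟨i, ⟨hi, hi'⟩, rfl⟩
  · refine ⟨2 * (i - 1), (occupied_even (by omega)).2 (by omega), ?_⟩
    rw [interleave_even _ _ (by omega)]
    congr 1
    omega
  · refine ⟨2 * (i - 1) + 1, (occupied_odd (by omega)).2 (by omega), ?_⟩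
    rw [interleave_odd _ _ (by omega)]
    congr 1
    omega

theorem interleave_mem_left (x y : ℕ → V) {q : ℕ} (hq : occupied n₁ n₂ q) (h : q % 2 = 0) :
    interleave x y q ∈ x '' Set.Icc 1 n₁ := by
  rw [interleave_even _ _ h]
  rw [occupied_even h] at hq
  exact ⟨_, ⟨by omega, by omega⟩, rfl⟩

theorem interleave_mem_right (x y : ℕ → V) {q : ℕ} (hq : occupied n₁ n₂ q) (h : q % 2 = 1) :
    interleave x y q ∈ y '' Set.Icc 1 n₂ := by
  rw [interleave_odd _ _ h]
  rw [occupied_odd h] at hq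
  exact ⟨_, ⟨by omega, by omega⟩, rfl⟩

theorem posAdj_parity (h : IsBipartitionEnumeration G n₁ n₂ x y) {q r : ℕ}
    (hqr : posAdj G (occupied n₁ n₂) (interleave x y) q r) : (q + r) % 2 = 1 := by
  obtain ⟨hq, hr, hadj⟩ := hqr
  have hd := Set.disjoint_left.1 h.bipartite.disjoint
  have hm := h.bipartite.mem_of_adj hadj
  by_contra hpar
  rcases Nat.mod_two_eq_zero_or_one q with h0 | h0
  · have h1 := interleave_mem_left x y hq h0
    have h2 := interleave_mem_left x y hr (by omega)
    rcases hm with hm | hm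
    · exact hd h2 hm.2
    · exact hd h1 hm.1
  · have h1 := interleave_mem_right x y hq h0
    have h2 := interleave_mem_right x y hr (by omega)
    rcases hm with hm | hm
    · exact hd hm.1 h1
    · exact hd hm.2 h2

theorem interleave_inj (h : IsBipartitionEnumeration G n₁ n₂ x y) {q r : ℕ}
    (hq : occupied n₁ n₂ q) (hr : occupied n₁ n₂ r) (he : interleave x y q = interleave x y r) :
    q = r := by
  have hd := Set.disjoint_left.1 h.bipartite.disjoint
  rcases Nat.mod_two_eq_zero_or_one q with h0 | h0 <;>
    rcases Nat.mod_two_eq_zero_or_one r with h1 | h1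
  · rw [interleave_even _ _ h0, interleave_even _ _ h1] at he
    rw [occupied_even h0] at hq
    rw [occupied_even h1] at hr
    have := h.injOn_x ⟨by omega, by omega⟩ ⟨by omega, by omega⟩ he
    omega
  · have h2 := interleave_mem_left x y hq h0
    rw [he] at h2
    exact (hd h2 (interleave_mem_right x y hr h1)).elim
  · have h2 := interleave_mem_left x y hr h1
    rw [← he] at h2
    exact (hd h2 (interleave_mem_right x y hq h0)).elim
  · rw [interleave_odd _ _ h0, interleave_odd _ _ h1] at he
    rw [occupied_odd h0] at hq
    rw [occupied_odd h1] at hr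
    have := h.injOn_y ⟨by omega, by omega⟩ ⟨by omega, by omega⟩ he
    omega

theorem posAdj_cross (h : IsBipartitionEnumeration G n₁ n₂ x y)
    (hs : IsStrongOrdering G n₁ n₂ x y) {q r q' r' : ℕ}
    (hqr : posAdj G (occupied n₁ n₂) (interleave x y) q r)
    (hqr' : posAdj G (occupied n₁ n₂) (interleave x y) q' r') (hq : q < q') (hr : r' < r)
    (hpar : (q + q') % 2 = 0) :
    posAdj G (occupied n₁ n₂) (interleave x y) q r' ∧
      posAdj G (occupied n₁ n₂) (interleave x y) q' r := by
  have p1 := posAdj_parity h hqr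
  have p2 := posAdj_parity h hqr'
  obtain ⟨a1, a2, a3⟩ := hqr
  obtain ⟨b1, b2, b3⟩ := hqr'
  suffices hk : G.Adj (interleave x y q) (interleave x y r') ∧
      G.Adj (interleave x y q') (interleave x y r) from ⟨⟨a1, b2, hk.1⟩, ⟨b1, a2, hk.2⟩⟩
  rcases Nat.mod_two_eq_zero_or_one q with h0 | h0
  · have h1 : q' % 2 = 0 := by omega
    have h2 : r % 2 = 1 := by omega
    have h3 : r' % 2 = 1 := by omega
    simp only [interleave_even x y h0, interleave_even x y h1, interleave_odd x y h2,
      interleave_odd x y h3] at a3 b3 ⊢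
    rw [occupied_even h0] at a1
    rw [occupied_odd h2] at a2
    rw [occupied_even h1] at b1
    rw [occupied_odd h3] at b2
    exact hs _ ⟨by omega, by omega⟩ _ ⟨by omega, by omega⟩ _ ⟨by omega, by omega⟩ _
      ⟨by omega, by omega⟩ a3 b3 (by omega) (by omega)
  · have h1 : q' % 2 = 1 := by omega
    have h2 : r % 2 = 0 := by omega
    have h3 : r' % 2 = 0 := by omega
    simp only [interleave_odd x y h0, interleave_odd x y h1, interleave_even x y h2,
      interleave_even x y h3] at a3 b3 ⊢
    rw [occupied_odd h0] at a1
    rw [occupied_even h2] at a2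
    rw [occupied_odd h1] at b1
    rw [occupied_even h3] at b2
    exact hs.symm _ ⟨by omega, by omega⟩ _ ⟨by omega, by omega⟩ _ ⟨by omega, by omega⟩ _
      ⟨by omega, by omega⟩ a3 b3 (by omega) (by omega)

theorem exists_layout [Nontrivial V] (hconn : G.Connected)
    (h : IsBipartitionEnumeration G n₁ n₂ x y) (hs : IsStrongOrdering G n₁ n₂ x y) :
    ∃ χ, Layout G χ (occupied n₁ n₂) (interleave x y) := by
  classical
  have hdown : ∀ q, occupied n₁ n₂ (q + 2) → occupied n₁ n₂ q := by
    intro q hq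
    unfold occupied at hq ⊢
    split_ifs at hq ⊢ <;> omega
  have hnbr : ∀ q, occupied n₁ n₂ q →
      ∃ r, posAdj G (occupied n₁ n₂) (interleave x y) q r := by
    intro q hq
    obtain ⟨v, hv⟩ := hconn.preconnected.exists_adj_of_nontrivial (interleave x y q)
    obtain ⟨r, hr, rfl⟩ := exists_occupied h v
    exact ⟨r, hq, hr, hv⟩
  refine ⟨fun v => if v ∈ x '' Set.Icc 1 n₁ then 0 else 1,
    ⟨hdown, fun q r hqr => hqr.1, fun q r hqr => ⟨hqr.2.1, hqr.1, hqr.2.2.symm⟩,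
      fun q r => posAdj_parity h, fun q r q' r' => posAdj_cross h hs, hnbr, ?_⟩,
    fun q r hq hr => interleave_inj h hq hr, ?_, ?_⟩
  · intro q hq2
    have hq := hdown q hq2
    -- A walk from `q` to `q + 2` must leave this set, and it can only do so from a common neighbour
    -- of some position up to `q` and some position from `q + 2` on.
    set S : Set V := {v | ∃ q', q' ≤ q ∧ (q' + q) % 2 = 0 ∧ occupied n₁ n₂ q' ∧
      (interleave x y q' = v ∨ G.Adj (interleave x y q') v)} with hS
    obtain ⟨w⟩ := hconn.preconnected (interleave x y q) (interleave x y (q + 2))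
    obtain ⟨d, -, hd1, hd2⟩ := w.exists_boundary_dart S
      ⟨q, le_rfl, by omega, hq, Or.inl rfl⟩ (by
        rintro ⟨q', hq', hpar, hP, he | hadj⟩
        · have := interleave_inj h hP hq2 he
          omega
        · have := posAdj_parity h ⟨hP, hq2, hadj⟩
          omega)
    obtain ⟨q', hq', hpar, hP, he | hadj⟩ := hd1
    · exact (hd2 ⟨q', hq', hpar, hP, Or.inr (by rw [he]; exact d.adj)⟩).elim
    obtain ⟨r, hr, her⟩ := exists_occupied h d.fst
    obtain ⟨q'', hq'', heq⟩ := exists_occupied h d.snd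
    have a1 : posAdj G (occupied n₁ n₂) (interleave x y) q' r := ⟨hP, hr, by rwa [her]⟩
    have a2 : posAdj G (occupied n₁ n₂) (interleave x y) q'' r :=
      ⟨hq'', hr, by rw [her, heq]; exact d.adj.symm⟩
    have p1 := posAdj_parity h a1
    have p2 := posAdj_parity h a2
    have hlt : q + 2 ≤ q'' := by
      by_contra! hlt
      exact hd2 ⟨q'', by omega, by omega, hq'', Or.inl heq⟩
    -- Neighbourhoods are intervals: any edge at a position between two neighbours of `r` either
    -- ends in `r` or crosses one of their edges to `r`.
    have key : ∀ t, occupied n₁ n₂ t → q' ≤ t → t ≤ q'' → (t + q) % 2 = 0 →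
        posAdj G (occupied n₁ n₂) (interleave x y) t r := by
      intro t ht h1 h2 h3
      rcases h1.eq_or_lt with rfl | h1
      · exact a1
      rcases h2.eq_or_lt with rfl | h2
      · exact a2
      obtain ⟨s, hs'⟩ := hnbr t ht
      rcases lt_trichotomy s r with hsr | rfl | hsr
      · exact (posAdj_cross h hs a1 hs' h1 hsr (by omega)).2
      · exact hs'
      · exact (posAdj_cross h hs hs' a2 h2 hsr (by omega)).1
    exact ⟨r, key q hq hq' (by omega) (by omega), key (q + 2) hq2 (by omega) hlt (by omega)⟩
  · intro q hq
    rcases Nat.mod_two_eq_zero_or_one q with h0 | h0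
    · rw [if_pos (interleave_mem_left x y hq h0), h0]
    · rw [if_neg, h0]
      exact fun hm => Set.disjoint_left.1 h.bipartite.disjoint hm
        (interleave_mem_right x y hq h0)
  · intro u v huv
    have hd := Set.disjoint_left.1 h.bipartite.disjoint
    rcases h.bipartite.mem_of_adj huv with ⟨hu, hv⟩ | ⟨hu, hv⟩
    · rw [if_pos hu, if_neg fun hv' => hd hv' hv]
      omega
    · rw [if_pos hv, if_neg fun hu' => hd hu' hu]
      omega

end Initial

/-! ### Removals and returned paths in terms of positions -/

section Drop

variable {m n p : ℕ}

theorem occupied_skip_even (hp : p % 2 = 0) (h : occupied m n (p + 2)) :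
    occupied (m - 1) n = fun q => occupied m n (skip p q) := by
  funext q
  unfold occupied skip at *
  split_ifs at * <;> first | omega | (apply propext; omega)

theorem occupied_skip_odd (hp : p % 2 = 1) (h : occupied m n (p + 2)) :
    occupied m (n - 1) = fun q => occupied m n (skip p q) := by
  funext q
  unfold occupied skip at *
  split_ifs at * <;> first | omega | (apply propext; omega)

theorem interleave_dropAt_left (a b : ℕ → V) (hp : p % 2 = 0) :
    interleave (dropAt a (p / 2 + 1)) b = fun q => interleave a b (skip p q) := by
  funext q
  unfold interleave dropAt skip
  split_ifs <;> first | omega | rfl | (congr 1; omega)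

theorem interleave_dropAt_right (a b : ℕ → V) (hp : p % 2 = 1) :
    interleave a (dropAt b (p / 2 + 1)) = fun q => interleave a b (skip p q) := by
  funext q
  unfold interleave dropAt skip
  split_ifs <;> first | omega | rfl | (congr 1; omega)

theorem evenPath_eq [DecidableEq V] (a b : ℕ → V) (hp : p % 2 = 1) :
    evenPath a b (p / 2 + 1) = pathEdges (interleave a b) p := by
  ext e
  simp only [evenPath, pathEdges, Finset.mem_union, Finset.mem_image, Finset.mem_Icc,
    Finset.mem_range]
  constructor
  · rintro (⟨i, hi, rfl⟩ | ⟨i, hi, rfl⟩)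
    · refine ⟨2 * (i - 1), by omega, ?_⟩
      rw [interleave_even _ _ (by omega), interleave_odd _ _ (by omega)]
      congr 3 <;> omega
    · refine ⟨2 * (i - 1) + 1, by omega, ?_⟩
      rw [interleave_odd _ _ (by omega), interleave_even _ _ (by omega)]
      congr 3 <;> omega
  · rintro ⟨q, hq, rfl⟩
    rcases Nat.mod_two_eq_zero_or_one q with h0 | h0
    · refine Or.inl ⟨q / 2 + 1, by omega, ?_⟩
      rw [interleave_even _ _ h0, interleave_odd _ _ (by omega)]
      congr 3 <;> omega
    · refine Or.inr ⟨q / 2 + 1, by omega, ?_⟩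
      rw [interleave_odd _ _ h0, interleave_even _ _ (by omega)]
      congr 3 <;> omega

theorem oddPath_eq [DecidableEq V] (a b : ℕ → V) (hp : p % 2 = 0) :
    oddPath a b (p / 2) = pathEdges (interleave a b) p := by
  ext e
  simp only [oddPath, pathEdges, Finset.mem_union, Finset.mem_image, Finset.mem_Icc,
    Finset.mem_range]
  constructor
  · rintro (⟨i, hi, rfl⟩ | ⟨i, hi, rfl⟩)
    · refine ⟨2 * (i - 1), by omega, ?_⟩
      rw [interleave_even _ _ (by omega), interleave_odd _ _ (by omega)]
      congr 3 <;> omega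
    · refine ⟨2 * (i - 1) + 1, by omega, ?_⟩
      rw [interleave_odd _ _ (by omega), interleave_even _ _ (by omega)]
      congr 3 <;> omega
  · rintro ⟨q, hq, rfl⟩
    rcases Nat.mod_two_eq_zero_or_one q with h0 | h0
    · refine Or.inl ⟨q / 2 + 1, by omega, ?_⟩
      rw [interleave_even _ _ h0, interleave_odd _ _ (by omega)]
      congr 3 <;> omega
    · refine Or.inr ⟨q / 2 + 1, by omega, ?_⟩
      rw [interleave_odd _ _ h0, interleave_even _ _ (by omega)]
      congr 3 <;> omega

end Drop

/-! ### Types as goodness of positions -/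

section Types

variable (G : SimpleGraph V) [DecidableRel G.Adj]

theorem le_lastNbr {L : ℕ → V} {n k : ℕ} {v : V} (hk : 1 ≤ k) :
    k ≤ lastNbr G L n v ↔ ∃ j, k ≤ j ∧ j ≤ n ∧ G.Adj v (L j) := by
  rw [lastNbr, Finset.le_sup_iff (show ⊥ < k from hk)]
  simp only [Finset.mem_filter, Finset.mem_Icc, id]
  constructor
  · rintro ⟨j, ⟨⟨-, h1⟩, h2⟩, h3⟩
    exact ⟨j, h3, h1, h2⟩
  · rintro ⟨j, h1, h2, h3⟩
    exact ⟨j, ⟨⟨by omega, h2⟩, h3⟩, h1⟩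

variable {G} {χ : V → ℕ} {m n q : ℕ} {a b : ℕ → V}

/-- The `j`-th entry of the second side sits at `2j - 1` and that of the first at `2j - 2`. So later
than the `i`-th means `j ≥ i` when seen from the first side and `j ≥ i + 1` from the second, which
is the asymmetry in both definitions of type. -/
theorem good_even (hL : Layout G χ (occupied m n) (interleave a b)) (hq : occupied m n q)
    (h0 : q % 2 = 0) :
    Good (posAdj G (occupied m n) (interleave a b)) q ↔
      q / 2 + 1 ≤ lastNbr G b n (a (q / 2 + 1)) := by
  rw [le_lastNbr G (by omega)]
  constructor
  · rintro ⟨r, hr, hqr⟩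
    have hpar := hL.stair.parity _ _ hqr
    obtain ⟨-, hr', hadj⟩ := hqr
    rw [interleave_even _ _ h0, interleave_odd _ _ (by omega)] at hadj
    rw [occupied_odd (by omega)] at hr'
    exact ⟨r / 2 + 1, by omega, by omega, hadj⟩
  · rintro ⟨j, h1, h2, h3⟩
    refine ⟨2 * (j - 1) + 1, by omega, hq, (occupied_odd (by omega)).2 (by omega), ?_⟩
    rw [interleave_even _ _ h0, interleave_odd _ _ (by omega)]
    convert h3 using 2
    omega

theorem good_odd (hL : Layout G χ (occupied m n) (interleave a b)) (hq : occupied m n q)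
    (h0 : q % 2 = 1) :
    Good (posAdj G (occupied m n) (interleave a b)) q ↔
      q / 2 + 1 + 1 ≤ lastNbr G a m (b (q / 2 + 1)) := by
  rw [le_lastNbr G (by omega)]
  constructor
  · rintro ⟨r, hr, hqr⟩
    have hpar := hL.stair.parity _ _ hqr
    obtain ⟨-, hr', hadj⟩ := hqr
    rw [interleave_odd _ _ h0, interleave_even _ _ (by omega)] at hadj
    rw [occupied_even (by omega)] at hr'
    exact ⟨r / 2 + 1, by omega, by omega, hadj⟩
  · rintro ⟨j, h1, h2, h3⟩
    refine ⟨2 * (j - 1), by omega, hq, (occupied_even (by omega)).2 (by omega), ?_⟩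
    rw [interleave_odd _ _ h0, interleave_even _ _ (by omega)]
    convert h3 using 2
    omega

end Types

end BipPermMIST

/-! ### One round of the algorithm in terms of positions -/

namespace BipPermMIST

variable {V : Type*}

/-- The positions that are occupied in the current visiting order. -/
def State.pres (s : State V) : ℕ → Prop :=
  if s.flag2 then occupied s.n₂ s.n₁ else occupied s.n₁ s.n₂

/-- The vertices in the current visiting order. -/
def State.place (s : State V) : ℕ → V :=
  if s.flag2 then interleave s.y s.x else interleave s.x s.y

section

variable {G : SimpleGraph V} [DecidableRel G.Adj] {χ : V → ℕ} {s : State V}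

theorem test_iff (hL : Layout G χ s.pres s.place) (q : ℕ) :
    (if s.flag2 then s.present (beta q) && !s.isType2 G (beta q)
      else s.present (alpha q) && !s.isType1 G (alpha q)) = true ↔
      s.pres q ∧ ¬ Good (posAdj G s.pres s.place) q := by
  obtain ⟨n₁, n₂, x, y, f, pos, E⟩ := s
  rcases Nat.mod_two_eq_zero_or_one q with h0 | h0 <;> cases f
  all_goals
    simp only [State.pres, State.place, Bool.false_eq_true, if_true, if_false] at hL ⊢
    simp only [alpha, beta, h0, if_true, State.present, State.isType1, State.isType2,
      Bool.and_eq_true, Bool.not_eq_true', decide_eq_true_eq, decide_eq_false_iff_not,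
      one_ne_zero, if_false]
  · refine (and_congr_left' ?_).trans (and_congr_right fun hq => not_congr (good_even hL hq h0).symm)
    rw [occupied_even h0]; omega
  · refine (and_congr_left' ?_).trans (and_congr_right fun hq => not_congr (good_even hL hq h0).symm)
    rw [occupied_even h0]; omega
  · refine (and_congr_left' ?_).trans (and_congr_right fun hq => not_congr (good_odd hL hq h0).symm)
    rw [occupied_odd h0]; omega
  · refine (and_congr_left' ?_).trans (and_congr_right fun hq => not_congr (good_odd hL hq h0).symm)
    rw [occupied_odd h0]; omega

theorem State.lt_of_pres {q : ℕ} (h : s.pres q) : q < 2 * (s.n₁ + s.n₂) := by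
  unfold State.pres occupied at h
  split_ifs at h <;> omega

/-- If all positions were good, later neighbours would climb beyond the finitely many occupied ones.
As everything before `s.pos` is good, resuming the search there finds the first bad position
overall. -/
theorem exists_nextEncountered (hL : Layout G χ s.pres s.place)
    (hg : ∀ q, q < s.pos → s.pres q → Good (posAdj G s.pres s.place) q)
    (hne : ∃ q, s.pres q) :
    ∃ p, s.pos ≤ p ∧ s.nextEncountered G = some p ∧ Event G s.pres s.place p := by
  classical
  have hex : ∃ q, s.pres q ∧ ¬ Good (posAdj G s.pres s.place) q := by
    by_contra! hall
    have : ∀ k, ∃ q, k ≤ q ∧ s.pres q := by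
      intro k
      induction k with
      | zero => exact hne.imp fun q hq => ⟨by omega, hq⟩
      | succ k ih =>
        obtain ⟨q, hq, hP⟩ := ih
        obtain ⟨r, hr, hqr⟩ := hall q hP
        exact ⟨r, by omega, hqr.2.1⟩
    obtain ⟨q, hq, hP⟩ := this (2 * (s.n₁ + s.n₂))
    have := State.lt_of_pres hP
    omega
  have hp := Nat.find_spec hex
  have hmin : ∀ q, q < Nat.find hex → s.pres q → Good (posAdj G s.pres s.place) q := by
    intro q hq hP
    by_contra hn
    exact Nat.find_min hex hq ⟨hP, hn⟩
  have hpos : s.pos ≤ Nat.find hex := by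
    by_contra! hlt
    exact hp.2 (hg _ hlt hp.1)
  refine ⟨Nat.find hex, hpos, ?_, hp.1, hmin, hp.2⟩
  rw [State.nextEncountered, List.find?_range_eq_some]
  refine ⟨?_, List.mem_range.2 (State.lt_of_pres hp.1), ?_⟩
  · rw [Bool.and_eq_true, test_iff hL]
    exact ⟨by simpa using hpos, hp⟩
  · intro q hq
    rw [Bool.not_eq_true', ← Bool.not_eq_true, Bool.and_eq_true, test_iff hL]
    exact fun h => Nat.find_min hex hq h.2

variable [DecidableEq V]

/-- One round, in terms of positions. -/
theorem step_eq {p : ℕ} (hnext : s.nextEncountered G = some p) (hpres : s.pres p)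
    (hp : 1 ≤ p)
    (hcond : s.flag2 = false → p % 2 = 1 →
      ¬ ∀ i ∈ Finset.Icc 1 (p / 2), G.Adj (s.x i) (s.y (i + 1))) :
    (s.pres (p + 2) ∧ ∃ s', step G s = Outcome.next s' ∧ s'.n₁ + s'.n₂ < s.n₁ + s.n₂ ∧
      s'.flag2 = s.flag2 ∧ s'.pos = p ∧ s'.pres = (fun q => s.pres (skip p q)) ∧
      s'.place = (fun q => s.place (skip p q)) ∧
      s'.E = insert s(s.place (p - 1), s.place p) s.E) ∨
    (¬ s.pres (p + 2) ∧ step G s = Outcome.ret (s.E ∪ pathEdges s.place p)) := by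
  obtain ⟨n₁, n₂, x, y, f, pos, E⟩ := s
  rcases Nat.mod_two_eq_zero_or_one p with h0 | h0 <;> cases f
  · simp only [State.pres, State.place, Bool.false_eq_true, if_false] at *
    by_cases hlast : p / 2 + 1 = n₁
    · right
      refine ⟨by rw [occupied_even (by omega)]; omega, ?_⟩
      simp only [step, hnext, alpha, h0, hlast, if_true, ne_eq, not_true, if_false]
      rw [← hlast, Nat.add_sub_cancel, oddPath_eq _ _ h0]
    · left
      have hP : occupied n₁ n₂ (p + 2) := by
        rw [occupied_even h0] at hpres
        rw [occupied_even (by omega)]; omega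
      refine ⟨hP, (State.mk n₁ n₂ x y false pos E).peelX (p / 2 + 1) (p / 2 + 1 - 1) p,
        by simp only [step, hnext, alpha, h0, hlast, if_true, ne_eq, not_false_eq_true],
        ?_, rfl, rfl, ?_, ?_, ?_⟩
      · rw [occupied_even h0] at hpres
        simp only [State.peelX]; omega
      · simp only [State.peelX, Bool.false_eq_true, if_false]
        exact occupied_skip_even h0 hP
      · simp only [State.peelX, Bool.false_eq_true, if_false]
        exact interleave_dropAt_left x y h0
      · simp only [State.peelX]
        rw [interleave_even _ _ h0, interleave_odd _ _ (by omega)]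
        congr 4; omega
  · simp only [State.pres, State.place, if_true] at *
    by_cases hlast : p / 2 + 1 = n₂
    · right
      refine ⟨by rw [occupied_even (by omega)]; omega, ?_⟩
      simp only [step, hnext, beta, h0, hlast, if_true, ne_eq, not_true, if_false,
        Bool.true_eq_false]
      rw [← hlast, Nat.add_sub_cancel, oddPath_eq _ _ h0]
    · left
      have hP : occupied n₂ n₁ (p + 2) := by
        rw [occupied_even h0] at hpres
        rw [occupied_even (by omega)]; omega
      refine ⟨hP, (State.mk n₁ n₂ x y true pos E).peelY (p / 2 + 1) (p / 2 + 1 - 1) p,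
        by simp only [step, hnext, beta, h0, hlast, if_true, ne_eq,
        not_false_eq_true, Bool.true_eq_false, if_false], ?_, rfl, rfl, ?_, ?_, ?_⟩
      · rw [occupied_even h0] at hpres
        simp only [State.peelY]; omega
      · simp only [State.peelY, if_true]
        exact occupied_skip_even h0 hP
      · simp only [State.peelY, if_true]
        exact interleave_dropAt_left y x h0
      · simp only [State.peelY]
        rw [interleave_even _ _ h0, interleave_odd _ _ (by omega)]
        congr 4; omega
  · simp only [State.pres, State.place, Bool.false_eq_true, if_false] at *
    have hc := hcond trivial h0
    by_cases hlast : p / 2 + 1 = n₂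
    · right
      refine ⟨by rw [occupied_odd (by omega)]; omega, ?_⟩
      simp only [step, hnext, alpha, h0, if_true, one_ne_zero, if_false, Nat.add_sub_cancel, hc]
      rw [if_neg (by simpa using hlast), evenPath_eq _ _ h0]
    · left
      have hP : occupied n₁ n₂ (p + 2) := by
        rw [occupied_odd h0] at hpres
        rw [occupied_odd (by omega)]; omega
      refine ⟨hP, (State.mk n₁ n₂ x y false pos E).peelY (p / 2 + 1) (p / 2 + 1) p,
        by simp only [step, hnext, alpha, h0, if_true, one_ne_zero, if_false,
        Nat.add_sub_cancel, hc, hlast, ne_eq, not_false_eq_true], ?_, rfl, rfl, ?_, ?_, ?_⟩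
      · rw [occupied_odd h0] at hpres
        simp only [State.peelY]; omega
      · simp only [State.peelY, Bool.false_eq_true, if_false]
        exact occupied_skip_odd h0 hP
      · simp only [State.peelY, Bool.false_eq_true, if_false]
        exact interleave_dropAt_right x y h0
      · simp only [State.peelY]
        rw [interleave_odd _ _ h0, interleave_even _ _ (by omega)]
        congr 4; omega
  · simp only [State.pres, State.place, if_true] at *
    by_cases hlast : p / 2 + 1 = n₁
    · right
      refine ⟨by rw [occupied_odd (by omega)]; omega, ?_⟩
      simp only [step, hnext, beta, h0, one_ne_zero, if_false, hlast, ne_eq, not_true,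
        Bool.true_eq_false]
      rw [← hlast, evenPath_eq _ _ h0]
    · left
      have hP : occupied n₂ n₁ (p + 2) := by
        rw [occupied_odd h0] at hpres
        rw [occupied_odd (by omega)]; omega
      refine ⟨hP, (State.mk n₁ n₂ x y true pos E).peelX (p / 2 + 1) (p / 2 + 1) p,
        by simp only [step, hnext, beta, h0, one_ne_zero, if_false, hlast, ne_eq,
        not_false_eq_true, Bool.true_eq_false, if_true], ?_, rfl, rfl, ?_, ?_, ?_⟩
      · rw [occupied_odd h0] at hpres
        simp only [State.peelX]; omega
      · simp only [State.peelX, if_true]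
        exact occupied_skip_odd h0 hP
      · simp only [State.peelX, if_true]
        exact interleave_dropAt_right y x h0
      · simp only [State.peelX]
        rw [interleave_odd _ _ h0, interleave_even _ _ (by omega)]
        congr 4; omega

end

end BipPermMIST

/-! ### The loop invariant and correctness -/

namespace BipPermMIST

variable {V : Type*} {G : SimpleGraph V}

/-- The edge set `E` is that of a maximum internal spanning tree. -/
def IsMISTEdges (G : SimpleGraph V) (E : Finset (Sym2 V)) : Prop :=
  ∃ T : SimpleGraph V, (E : Set (Sym2 V)) = T.edgeSet ∧ IsMIST G T

/-- An even position before `l` whose neighbours come at most one position later. -/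
def Wall (G : SimpleGraph V) (P : ℕ → Prop) (c : ℕ → V) (l : ℕ) : Prop :=
  ∃ e, e + 2 ≤ l ∧ e % 2 = 0 ∧ ∀ r, P r → G.Adj (c e) (c r) → r ≤ e + 1

/-- The invariant of the while loops after the first removal. -/
structure LoopInvariant (G : SimpleGraph V) (s : State V) : Prop where
  layout : ∃ χ, Layout G χ s.pres s.place ∧ ∃ D, Attached G s.pres s.place s.E D ∧
    ∃ S m A B, A.Nonempty ∧ Cert G χ s.pres s.place s.pos s.pos D.card S m A B
  good : ∀ q, q < s.pos → s.pres q → Good (posAdj G s.pres s.place) q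
  nonempty : ∃ q, s.pres q
  wall : s.flag2 = false → Wall G s.pres s.place s.pos

section

variable {χ : V → ℕ} {s : State V} {p : ℕ} {D : Finset V}

/-- A wall at `e` is a vertex `x_i` not adjacent to `y_{i+1}`, which sits at `e + 3`. So once there
is a wall, the flag never switches. -/
theorem not_forall_adj_of_wall (hL : Layout G χ s.pres s.place) (hE : Event G s.pres s.place p)
    (hf : s.flag2 = false) (hp : p % 2 = 1) (hw : Wall G s.pres s.place p) :
    ¬ ∀ i ∈ Finset.Icc 1 (p / 2), G.Adj (s.x i) (s.y (i + 1)) := by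
  intro hall
  obtain ⟨e, he, he2, hwall⟩ := hw
  have h1 := hall (e / 2 + 1) (by rw [Finset.mem_Icc]; omega)
  have h2 := hwall (e + 3) (hE.present_of_le hL (by omega)) (by
    simp only [State.place, hf, Bool.false_eq_true, if_false]
    rw [interleave_even _ _ he2, interleave_odd _ _ (by omega)]
    convert h1 using 2
    omega)
  omega

variable [Fintype V] [DecidableEq V] [DecidableRel G.Adj]

theorem step_of_cert [Nontrivial V] (hL : Layout G χ s.pres s.place)
    (hnext : s.nextEncountered G = some p) (hE : Event G s.pres s.place p)
    (hA : Attached G s.pres s.place s.E D) {t m : ℕ} {S : Set V} {A B : Finset V}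
    (hC : Cert G χ s.pres s.place t t D.card S m A B) (ht : t ≤ p)
    (hAne : A.Nonempty ∨ (p + t) % 2 = 0)
    (hw : s.flag2 = false → p % 2 = 0 ∨ Wall G s.pres s.place p) :
    (∃ E, step G s = Outcome.ret E ∧ IsMISTEdges G E) ∨
      ∃ s', step G s = Outcome.next s' ∧ s'.n₁ + s'.n₂ < s.n₁ + s.n₂ ∧ LoopInvariant G s' := by
  have hp1 := hE.pos hL
  obtain ⟨S', m', A', B', hA'ne, hC'⟩ := hC.extend hL hE ht hAne
  have hcond : s.flag2 = false → p % 2 = 1 →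
      ¬ ∀ i ∈ Finset.Icc 1 (p / 2), G.Adj (s.x i) (s.y (i + 1)) := fun hf hp =>
    not_forall_adj_of_wall hL hE hf hp ((hw hf).resolve_left (by omega))
  rcases step_eq hnext hE.present hp1 hcond with
    ⟨hP, s', hstep, hlt, hflag, hpos, hpres, hplace, hEdges⟩ | ⟨hP, hstep⟩
  · refine Or.inr ⟨s', hstep, hlt, ?_⟩
    refine ⟨⟨χ, ?_, insert (s.place p) D, ?_, S', m', A', B', hA'ne, ?_⟩, ?_, ?_, ?_⟩
    · rw [hpres, hplace]
      exact hL.remove hE hP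
    · rw [hpres, hplace, hEdges]
      exact hA.remove hL hE
    · rw [hpres, hplace, hpos, Finset.card_insert_of_notMem (hA.notMem p hE.present)]
      exact hC'.remove
    · rw [hpres, hplace, hpos]
      exact fun q hq _ => hL.good_remove hE hP hq
    · rw [hpres]
      exact ⟨p, by simpa only [skip_of_even (p := p) (by omega) le_rfl] using hP⟩
    · rw [hflag, hpres, hplace, hpos]
      intro hf
      have hwall : Wall G s.pres s.place p := by
        rcases hw hf with hp2 | hw
        · refine ⟨p - 2, by omega, by omega, fun r hr hadj => ?_⟩
          have := hE.nbr_lt hL (by omega) (by omega) hr hadj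
          omega
        · exact hw
      obtain ⟨e, he, he2, hwall⟩ := hwall
      refine ⟨e, he, he2, fun r hr hadj => (le_skip p r).trans (hwall _ hr ?_)⟩
      simpa only [skip_of_lt (p := p) (q := e) (by omega)] using hadj
  · refine Or.inl ⟨_, hstep, hA.finish hL hE hP ?_⟩
    exact (hC'.leafBound hL hA'ne).mono (Set.subset_univ _) le_rfl

end

/-- Treated separately because the bounds on leaves need every vertex to have a neighbour. -/
theorem exists_run_of_subsingleton [DecidableEq V] [DecidableRel G.Adj] [Subsingleton V]
    {n₁ n₂ : ℕ} {x y : ℕ → V} (hconn : G.Connected)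
    (henum : IsBipartitionEnumeration G n₁ n₂ x y) :
    ∃ m E, run G m (initialState n₁ n₂ x y) = some E ∧ IsMISTEdges G E := by
  have hM : IsMISTEdges G ∅ := by
    refine ⟨⊥, by simp, ⟨bot_le, ?_⟩, ?_⟩
    · have := hconn.nonempty
      exact SimpleGraph.IsTree.of_subsingleton
    · intro T' _
      rw [Subsingleton.elim T' ⊥]
  have hn₁ : n₁ ≤ 1 := by
    by_contra! h
    have := henum.injOn_x (show 1 ∈ _ from ⟨by omega, by omega⟩)
      (show 2 ∈ _ from ⟨by omega, by omega⟩)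
      (Subsingleton.elim _ _)
    omega
  have hn₂ : n₂ ≤ 1 := by
    by_contra! h
    have := henum.injOn_y (show 1 ∈ _ from ⟨by omega, by omega⟩)
      (show 2 ∈ _ from ⟨by omega, by omega⟩)
      (Subsingleton.elim _ _)
    omega
  have hlow : ¬ (1 ≤ n₁ ∧ 1 ≤ n₂) := by
    rintro ⟨h₁, h₂⟩
    have hx : x 1 ∈ x '' Set.Icc 1 n₁ := ⟨1, ⟨le_rfl, h₁⟩, rfl⟩
    exact Set.disjoint_left.1 henum.bipartite.disjoint hx ⟨1, ⟨le_rfl, h₂⟩, Subsingleton.elim _ _⟩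
  obtain ⟨v₀⟩ := hconn.nonempty
  obtain ⟨q, hq, -⟩ := exists_occupied henum v₀
  have hpos : 1 ≤ n₁ ∨ 1 ≤ n₂ := by
    unfold occupied at hq
    split_ifs at hq <;> omega
  have hlast : ∀ L : ℕ → V, ∀ v, lastNbr G L 0 v = 0 := by
    intro L v
    simp [lastNbr]
  rcases hpos with h | h
  · obtain rfl : n₁ = 1 := by omega
    obtain rfl : n₂ = 0 := by omega
    refine ⟨1, ∅, ?_, hM⟩
    simp [run, step, State.nextEncountered, initialState, List.range_succ, alpha, State.present,
      State.isType1, hlast, oddPath]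
  · obtain rfl : n₂ = 1 := by omega
    obtain rfl : n₁ = 0 := by omega
    -- Two rounds: the condition at `y_1` is vacuous, so the flag switches before the return.
    refine ⟨2, ∅, ?_, hM⟩
    simp [run, step, State.nextEncountered, initialState, List.range_succ, alpha, beta,
      State.present, State.isType1, State.isType2, hlast, oddPath]

variable [Fintype V] [DecidableEq V] [DecidableRel G.Adj]

theorem exists_run_of_loopInvariant [Nontrivial V] (n : ℕ) :
    ∀ s : State V, s.n₁ + s.n₂ ≤ n → LoopInvariant G s →
      ∃ m E, run G m s = some E ∧ IsMISTEdges G E := by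
  induction n with
  | zero =>
    intro s hs hI
    obtain ⟨q, hq⟩ := hI.nonempty
    have := State.lt_of_pres hq
    omega
  | succ n ih =>
    intro s hs hI
    obtain ⟨χ, hL, D, hA, S, m, A, B, hAne, hC⟩ := hI.layout
    obtain ⟨p, hp, hnext, hE⟩ := exists_nextEncountered hL hI.good hI.nonempty
    rcases step_of_cert hL hnext hE hA hC hp (Or.inl hAne) (fun hf => Or.inr (by
      obtain ⟨e, he, hw⟩ := hI.wall hf
      exact ⟨e, by omega, hw⟩)) with ⟨E, hstep, hM⟩ | ⟨s', hstep, hlt, hI'⟩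
    · exact ⟨1, E, by simp only [run, hstep], hM⟩
    · obtain ⟨k, E, hk, hM⟩ := ih s' (by omega) hI'
      exact ⟨k + 1, E, by simp only [run, hstep, hk], hM⟩

theorem exists_run_of_step [Nontrivial V] {s : State V}
    (h : (∃ E, step G s = Outcome.ret E ∧ IsMISTEdges G E) ∨
      ∃ s', step G s = Outcome.next s' ∧ s'.n₁ + s'.n₂ < s.n₁ + s.n₂ ∧ LoopInvariant G s') :
    ∃ m E, run G m s = some E ∧ IsMISTEdges G E := by
  rcases h with ⟨E, hstep, hM⟩ | ⟨s', hstep, -, hI'⟩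
  · exact ⟨1, E, by simp only [run, hstep], hM⟩
  · obtain ⟨k, E, hk, hM⟩ := exists_run_of_loopInvariant _ s' le_rfl hI'
    exact ⟨k + 1, E, by simp only [run, hstep, hk], hM⟩

/-! ### The first event and the switch of flags -/

section Start

variable {n₁ n₂ : ℕ} {x y : ℕ → V}

/-- The run from the switch to `flag = 2`, which happens at the position `p₀` of the first order. -/
theorem exists_run_flag2 [Nontrivial V] {χ χ' : V → ℕ}
    (henum : IsBipartitionEnumeration G n₁ n₂ x y)
    (hL : Layout G χ (occupied n₁ n₂) (interleave x y))
    (hL' : Layout G χ' (occupied n₂ n₁) (interleave y x)) {p₀ : ℕ}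
    (hE₀ : Event G (occupied n₁ n₂) (interleave x y) p₀) (hp₀ : p₀ % 2 = 1)
    (hcond : ∀ i ∈ Finset.Icc 1 (p₀ / 2), G.Adj (x i) (y (i + 1))) :
    ∃ m E, run G m { initialState n₁ n₂ x y with flag2 := true, pos := 0 } = some E ∧
      IsMISTEdges G E := by
  set s : State V := { initialState n₁ n₂ x y with flag2 := true, pos := 0 } with hs
  have hpres : s.pres = occupied n₂ n₁ := rfl
  have hplace : s.place = interleave y x := rfl
  have hcover : ∀ v, ∃ q, s.pres q ∧ s.place q = v := fun v => exists_occupied henum.symm v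
  rw [← hpres, ← hplace] at hL'
  obtain ⟨v₀⟩ : Nonempty V := inferInstance
  obtain ⟨p, -, hnext, hE⟩ := exists_nextEncountered hL' (fun q hq => by simp [hs] at hq)
    ((hcover v₀).imp fun q hq => hq.1)
  have hA : Attached G s.pres s.place s.E ∅ := Attached.start hcover
  rcases Nat.mod_two_eq_zero_or_one p with h0 | h0
  · exact exists_run_of_step (step_of_cert hL' hnext hE hA (Cert.start hcover) (Nat.zero_le _)
      (Or.inr (by omega)) (by simp [hs]))
  have hP₀ : ∀ q ≤ p₀, s.pres q := by
    intro q hq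
    rw [hpres]
    have h1 := hE₀.present_of_le hL hq
    have h2 := hE₀.present_of_le hL (q := p₀ - 1) (by omega)
    have h3 := hE₀.present
    unfold occupied at *
    split_ifs at * <;> omega
  -- The vertex `y_k` that caused the switch moves from `p₀` to the even position `p₀ - 1` and has
  -- no neighbour past `x_k`, now at `p₀`. In general an `x` at position `r` of the new order was at
  -- `r - 1`.
  have hwall : ∀ r, s.pres r → G.Adj (s.place (p₀ - 1)) (s.place r) → r ≤ p₀ - 1 + 1 := by
    intro r hr hadj
    have hpar := hL'.parity (hP₀ _ (by omega)) hr hadj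
    rw [hplace, interleave_even _ _ (by omega), interleave_odd _ _ (by omega)] at hadj
    rw [hpres, occupied_odd (by omega)] at hr
    have := hE₀.nbr_lt hL (q := p₀) (r := r - 1) le_rfl (by omega)
      ((occupied_even (by omega)).2 (by omega)) (by
        rw [interleave_odd _ _ hp₀, interleave_even _ _ (by omega)]
        convert hadj using 2 <;> omega)
    omega
  -- The edges `x_i y_{i+1}` tested before the switch make every odd position before `p₀` good in
  -- the new order.
  have hp₀p : p₀ ≤ p := by
    by_contra! hlt
    have hadj := hcond (p / 2 + 1) (by rw [Finset.mem_Icc]; omega)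
    refine hE.not_good ⟨p + 1, by omega, hE.present, hP₀ _ (by omega), ?_⟩
    rw [hplace, interleave_odd _ _ h0, interleave_even _ _ (by omega)]
    convert hadj using 2
    omega
  rcases hp₀p.eq_or_lt with rfl | hlt
  -- A common neighbour of `p₀` and `p₀ + 2` would lie at or before the wall at `p₀ - 1`, whose
  -- neighbours stop at `p₀`. So the run ends here with a Hamiltonian path.
  · have hlast : ¬ s.pres (p₀ + 2) := by
      intro hP
      obtain ⟨r, hr, hr'⟩ := hL'.stair.conn _ hP
      have hlt := hL'.stair.lt_of_not_good hE.not_good hr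
      have hpar := hL'.stair.parity _ _ hr
      have := hL'.stair.nbr_le (hP₀ (p₀ - 1) (by omega)) (fun q hq => hwall q hq.2.1 hq.2.2)
        (r := r) (by omega) (by omega) (hL'.stair.symm _ _ hr')
      omega
    refine exists_run_of_step (Or.inl ?_)
    rcases step_eq hnext hE.present (hE.pos hL') (by simp [hs]) with ⟨hP, -⟩ | ⟨-, hstep⟩
    · exact (hlast hP).elim
    · exact ⟨_, hstep, hA.finish hL' hE hlast (leafBound_two G)⟩
  · obtain ⟨A, B, hAne, hC⟩ := Cert.of_wall hcover hL' (hP₀ (p₀ - 1) (by omega)) (by omega) hwall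
    exact exists_run_of_step (step_of_cert hL' hnext hE hA hC (by omega) (Or.inl hAne)
      (by simp [hs]))

theorem exists_run_of_nontrivial [Nontrivial V] (hconn : G.Connected)
    (henum : IsBipartitionEnumeration G n₁ n₂ x y) (hstrong : IsStrongOrdering G n₁ n₂ x y) :
    ∃ m E, run G m (initialState n₁ n₂ x y) = some E ∧ IsMISTEdges G E := by
  set s : State V := initialState n₁ n₂ x y with hs
  obtain ⟨χ, hL⟩ := exists_layout hconn henum hstrong
  obtain ⟨χ', hL'⟩ := exists_layout hconn henum.symm hstrong.symm
  have hpres : s.pres = occupied n₁ n₂ := rfl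
  have hplace : s.place = interleave x y := rfl
  have hcover : ∀ v, ∃ q, s.pres q ∧ s.place q = v := fun v => exists_occupied henum v
  have hLs : Layout G χ s.pres s.place := hL
  obtain ⟨v₀⟩ : Nonempty V := inferInstance
  obtain ⟨p, -, hnext, hE⟩ := exists_nextEncountered hLs
    (fun q hq => by simp [hs, initialState] at hq) ((hcover v₀).imp fun q hq => hq.1)
  have hA : Attached G s.pres s.place s.E ∅ := Attached.start hcover
  rcases Nat.mod_two_eq_zero_or_one p with h0 | h0
  · exact exists_run_of_step (step_of_cert hLs hnext hE hA (Cert.start hcover) (Nat.zero_le _)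
      (Or.inr (by omega)) fun _ => Or.inl h0)
  by_cases hcond : ∀ i ∈ Finset.Icc 1 (p / 2), G.Adj (x i) (y (i + 1))
  · obtain ⟨m, E, hrun, hM⟩ := exists_run_flag2 henum hL hL' hE h0 hcond
    refine ⟨m + 1, E, ?_, hM⟩
    have hstep : step G s = Outcome.next { s with flag2 := true, pos := 0 } := by
      have hflag : s.flag2 = false := rfl
      simp only [step, hnext, hflag, if_true, alpha, h0, one_ne_zero, if_false]
      exact if_pos hcond
    simp only [run, hstep]
    exact hrun
  · push Not at hcond
    obtain ⟨i, hi, hadj⟩ := hcond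
    rw [Finset.mem_Icc] at hi
    have hP : ∀ q ≤ p, s.pres q := fun q hq => hE.present_of_le hLs hq
    -- The missing edge `x_i y_{i+1}` is a wall at the position of `x_i`: a longer edge there would
    -- cross the path edge from `x_{i+1}` to `y_{i+1}` and force it.
    have hwall : ∀ r, s.pres r → G.Adj (s.place (2 * (i - 1))) (s.place r) →
        r ≤ 2 * (i - 1) + 1 := by
      intro r hr hr'
      have hpar := hLs.parity (hP _ (by omega)) hr hr'
      have hne : ¬ G.Adj (s.place (2 * (i - 1))) (s.place (2 * (i - 1) + 3)) := by
        rw [hplace, interleave_even _ _ (by omega), interleave_odd _ _ (by omega)]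
        convert hadj using 3 <;> omega
      by_contra! hlt
      by_cases hr3 : r = 2 * (i - 1) + 3
      · exact hne (hr3 ▸ hr')
      · exact hne (hLs.stair.cross _ _ _ _ ⟨hP _ (by omega), hr, hr'⟩
          (hE.adj_succ hLs (q := 2 * (i - 1) + 2) (by omega)) (by omega) (by omega)
          (by omega)).1.2.2
    obtain ⟨A, B, hAne, hC⟩ := Cert.of_wall hcover hLs (hP (2 * (i - 1)) (by omega)) (by omega)
      hwall
    exact exists_run_of_step (step_of_cert hLs hnext hE hA hC (by omega) (Or.inl hAne)
      fun _ => Or.inr ⟨_, by omega, by omega, hwall⟩)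

end Start

end BipPermMIST

theorem mainTheorem1 {V : Type*} [Fintype V] [DecidableEq V]
    (G : SimpleGraph V) [DecidableRel G.Adj]
    (hG : BipPermMIST.IsBipartitePermutationGraph G) (hconn : G.Connected)
    (n₁ n₂ : ℕ) (x y : ℕ → V)
    (henum : BipPermMIST.IsBipartitionEnumeration G n₁ n₂ x y)
    (hstrong : BipPermMIST.IsStrongOrdering G n₁ n₂ x y) :
    ∃ T : SimpleGraph V,
      BipPermMIST.AlgorithmReturns G n₁ n₂ x y T ∧ BipPermMIST.IsMIST G T := by
  obtain ⟨m, E, hrun, T, hE, hT⟩ : ∃ m E,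
      BipPermMIST.run G m (BipPermMIST.initialState n₁ n₂ x y) = some E ∧
        BipPermMIST.IsMISTEdges G E := by
    rcases subsingleton_or_nontrivial V with hV | hV
    · exact BipPermMIST.exists_run_of_subsingleton hconn henum
    · exact BipPermMIST.exists_run_of_nontrivial hconn henum hstrong
  exact ⟨T, ⟨m, E, hrun, hE⟩, hT⟩
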